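/- Let $G=(V,E)$ be a finite simple graph with $n$ vertices and $m$ edges, and let $S$ be a BFS-tree of $G$, that is, a rooted spanning tree of $G$ such that every edge of $G$ not in $S$ joins two vertices on the same level or on consecutive levels of $S$ (the level of a vertex is its distance from the root in $S$). A straight-line compatible drawing of $\langle G,S\rangle$ places the vertices at distinct points of the plane and draws the edges as straight-line segments, no edge passing through a vertex that is not its end-vertex, such that no edge of $S$ is crossed by an edge of $G$ (an edge of $S$ and another edge of $G$ meet at most in a common end-vertex). Then the following hold. 1. There is a straight-line compatible drawing $\Gamma$ of $\langle G,S\rangle$ in which the levels of $S$ lie on nested concentric circles: there are a centre $o$ and radii $r_0>r_1>r_2>\dots>0$ such that every vertex of level $l$ has distance $r_l$ from $o$. 2. Such a drawing can be computed in $O(n+m)$ time in the real RAM model, when the input consists of $n$, $m$, the root of $S$, and the list of edges of $G$ (in any order) in which the edges of $S$ are marked. The area of the drawings computed by the algorithm may be exponential: for all sufficiently large $n$ there is an instance with $n$ vertices whose computed drawing has area at least $c\cdot 2^n$, where $c>0$ is a constant. Here the area of a drawing is the area of a smallest enclosing rectangle after scaling so that any two vertices have distance at least $1$. 3. Consequently,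 for every finite connected graph $G$ and every vertex $r$ of $G$ there is a BFS-tree $S$ of $G$ with root $r$ and a straight-line compatible drawing of $\langle G,S\rangle$; in particular, every finite connected graph has a spanning tree that is not crossed in some straight-line drawing of the graph. -/

import Mathlib

universe u

/-! ### Straight-line drawings -/

/-- The Euclidean plane. -/
abbrev Plane : Type := EuclideanSpace ℝ (Fin 2)

/-- `S` is a BFS-tree of `G` with root `root`: a rooted spanning tree of `G` such that every edge of
`G` that is not in `S` joins vertices on the same level or on consecutive levels of `S`. The level
of a vertex is its distance from the root in `S`. (`S` spans, being a graph on all of `V`.) -/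
structure IsBFSTree {V : Type u} (G S : SimpleGraph V) (root : V) : Prop where
  le : S ≤ G
  isTree : S.IsTree
  levels : ∀ a b, G.Adj a b → ¬ S.Adj a b →
    S.dist root a = S.dist root b ∨
    S.dist root a = S.dist root b + 1 ∨
    S.dist root b = S.dist root a + 1

/-- Vertices are distinct points, edges are segments, and no edge passes through a vertex other
than its end-vertices. -/
structure IsStraightLineDrawing {V : Type u} (G : SimpleGraph V) (Γ : V → Plane) : Prop where
  injective : Function.Injective Γ
  not_mem_edge : ∀ a b w, G.Adj a b → w ≠ a → w ≠ b → Γ w ∉ segment ℝ (Γ a) (Γ b)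

/-- A straight-line compatible drawing of `⟨G, S⟩`: a straight-line drawing of `G` in which no edge
of `S` is crossed by another edge of `G`, that is, an edge of `S` and another edge of `G` meet at
most in a common end-vertex. -/
structure IsCompatibleDrawing {V : Type u} (G S : SimpleGraph V) (Γ : V → Plane) : Prop where
  drawing : IsStraightLineDrawing G Γ
  not_crossed : ∀ a b c d, S.Adj a b → G.Adj c d → s(a, b) ≠ s(c, d) →
    segment ℝ (Γ a) (Γ b) ∩ segment ℝ (Γ c) (Γ d) ⊆ Γ '' (({a, b} : Set V) ∩ {c, d})

/-- The levels of the tree `S` lie on concentric circles, each strictly inside the previous one. -/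
def LevelsOnNestedCircles {V : Type u} (S : SimpleGraph V) (root : V) (Γ : V → Plane) : Prop :=
  ∃ (o : Plane) (r : ℕ → ℝ), StrictAnti r ∧ (∀ l, 0 < r l) ∧
    ∀ v, dist (Γ v) o = r (S.dist root v)

/-- The area of a straight-line drawing: the drawing is scaled so that any two vertices
are at distance at least one, and the area of a smallest enclosing rectangle (in any orientation)
is taken. -/
noncomputable def drawingArea {V : Type u} (Γ : V → Plane) : ℝ :=
  sInf {A : ℝ | ∃ s θ a b c d : ℝ, 0 < s ∧
    (∀ v w, v ≠ w → 1 ≤ s * dist (Γ v) (Γ w)) ∧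
    (∀ v, s * (Real.cos θ * Γ v 0 + Real.sin θ * Γ v 1) ∈ Set.Icc a b ∧
          s * (-Real.sin θ * Γ v 0 + Real.cos θ * Γ v 1) ∈ Set.Icc c d) ∧
    A = (b - a) * (d - c)}

/-! ### The real RAM -/

/-- Instructions of a real RAM. There are two memories, `I` of natural numbers (used for counting
and for addresses) and `R` of real numbers, a read-only input array of natural numbers and a
write-only output array of real numbers. -/
inductive RealRAM.Instr : Type
  /-- `I[d] := k` -/
  | iconst (d k : ℕ)
  /-- `I[d] := I[a] + I[b]` -/
  | iadd (d a b : ℕ)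
  /-- `I[d] := I[a] - I[b]`, truncated at `0` -/
  | isub (d a b : ℕ)
  /-- `I[d] := I[I[a]]` -/
  | iload (d a : ℕ)
  /-- `I[I[a]] := I[b]` -/
  | istore (a b : ℕ)
  /-- `I[d] := input[I[a]]` -/
  | input (d a : ℕ)
  /-- `R[d] := z` -/
  | rconst (d : ℕ) (z : ℤ)
  /-- `R[d] := I[a]` -/
  | cast (d a : ℕ)
  /-- `R[d] := R[a] + R[b]` -/
  | radd (d a b : ℕ)
  /-- `R[d] := R[a] - R[b]` -/
  | rsub (d a b : ℕ)
  /-- `R[d] := R[a] * R[b]` -/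
  | rmul (d a b : ℕ)
  /-- `R[d] := R[a] / R[b]`; the machine gets stuck if `R[b] = 0` -/
  | rdiv (d a b : ℕ)
  /-- `R[d] := R[I[a]]` -/
  | rload (d a : ℕ)
  /-- `R[I[a]] := R[b]` -/
  | rstore (a b : ℕ)
  /-- `output[I[a]] := R[b]` -/
  | output (a b : ℕ)
  /-- jump to instruction `l` if `I[a] ≤ I[b]` -/
  | ijump (a b l : ℕ)
  /-- jump to instruction `l` if `R[a] ≤ R[b]` -/
  | rjump (a b l : ℕ)
  /-- stop -/
  | halt

/-- A program is a finite list of instructions. -/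
abbrev RealRAM.Program : Type := List RealRAM.Instr

/-- A configuration: program counter, the two memories and the output array. -/
structure RealRAM.Config : Type where
  pc : ℕ
  I : ℕ → ℕ
  R : ℕ → ℝ
  out : ℕ → ℝ

/-- The initial configuration: everything is zero. -/
def RealRAM.Config.init : RealRAM.Config := ⟨0, fun _ => 0, fun _ => 0, fun _ => 0⟩

open Classical in
/-- Execution of one instruction on the input array `x`; `none` if there is no next
configuration. -/
noncomputable def RealRAM.exec (x : ℕ → ℕ) (c : RealRAM.Config) :
    RealRAM.Instr → Option RealRAM.Config
  | .iconst d k => some { c with pc := c.pc + 1, I := Function.update c.I d k }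
  | .iadd d a b => some { c with pc := c.pc + 1, I := Function.update c.I d (c.I a + c.I b) }
  | .isub d a b => some { c with pc := c.pc + 1, I := Function.update c.I d (c.I a - c.I b) }
  | .iload d a => some { c with pc := c.pc + 1, I := Function.update c.I d (c.I (c.I a)) }
  | .istore a b => some { c with pc := c.pc + 1, I := Function.update c.I (c.I a) (c.I b) }
  | .input d a => some { c with pc := c.pc + 1, I := Function.update c.I d (x (c.I a)) }
  | .rconst d z => some { c with pc := c.pc + 1, R := Function.update c.R d (z : ℝ) }
  | .cast d a => some { c with pc := c.pc + 1, R := Function.update c.R d (c.I a : ℝ) }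
  | .radd d a b => some { c with pc := c.pc + 1, R := Function.update c.R d (c.R a + c.R b) }
  | .rsub d a b => some { c with pc := c.pc + 1, R := Function.update c.R d (c.R a - c.R b) }
  | .rmul d a b => some { c with pc := c.pc + 1, R := Function.update c.R d (c.R a * c.R b) }
  | .rdiv d a b => if c.R b = 0 then none else
      some { c with pc := c.pc + 1, R := Function.update c.R d (c.R a / c.R b) }
  | .rload d a => some { c with pc := c.pc + 1, R := Function.update c.R d (c.R (c.I a)) }
  | .rstore a b => some { c with pc := c.pc + 1, R := Function.update c.R (c.I a) (c.R b) }
  | .output a b => some { c with pc := c.pc + 1, out := Function.update c.out (c.I a) (c.R b) }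
  | .ijump a b l => some { c with pc := if c.I a ≤ c.I b then l else c.pc + 1 }
  | .rjump a b l => some { c with pc := if c.R a ≤ c.R b then l else c.pc + 1 }
  | .halt => none

/-- One step of the program `P` on the input array `x`. -/
noncomputable def RealRAM.step (P : RealRAM.Program) (x : ℕ → ℕ) (c : RealRAM.Config) :
    Option RealRAM.Config :=
  P[c.pc]?.bind (RealRAM.exec x c)

/-- The configuration after `t` steps of `P` on the input array `x`, if there is one. -/
noncomputable def RealRAM.run (P : RealRAM.Program) (x : ℕ → ℕ) : ℕ → Option RealRAM.Config
  | 0 => some RealRAM.Config.init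
  | t + 1 => (RealRAM.run P x t).bind (RealRAM.step P x)

/-- On the input array `x`, the program `P` executes `t` instructions, then reaches the instruction
`halt`, and the output array is then `y`. -/
def RealRAM.HaltsWith (P : RealRAM.Program) (x : ℕ → ℕ) (t : ℕ) (y : ℕ → ℝ) : Prop :=
  ∃ c, RealRAM.run P x t = some c ∧ P[c.pc]? = some .halt ∧ c.out = y

/-! ### Instances and drawings as arrays -/

/-- `ends` lists the edges of `G`, each exactly once, in any order and with the end-vertices in any
order, and `mark` tells which of them are edges of `S`. -/
structure IsEdgeList {n m : ℕ} (G S : SimpleGraph (Fin n))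
    (ends : Fin m → Fin n × Fin n) (mark : Fin m → Bool) : Prop where
  injective : Function.Injective fun j => s((ends j).1, (ends j).2)
  range_eq : (Set.range fun j => s((ends j).1, (ends j).2)) = G.edgeSet
  mark_iff : ∀ j, mark j = true ↔ S.Adj (ends j).1 (ends j).2

/-- The input array of an instance: the number `n` of vertices, the number `m` of edges, the root,
and then three cells for every edge, namely its end-vertices and its mark. -/
def encodeInstance {n m : ℕ} (ends : Fin m → Fin n × Fin n) (mark : Fin m → Bool)
    (root : Fin n) : ℕ → ℕ
  | 0 => n
  | 1 => m
  | 2 => root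
  | k + 3 =>
    if h : k / 3 < m then
      if k % 3 = 0 then (ends ⟨k / 3, h⟩).1
      else if k % 3 = 1 then (ends ⟨k / 3, h⟩).2
      else (mark ⟨k / 3, h⟩).toNat
    else 0

/-- The drawing in an output array: vertex `v` has coordinates `(y[2v], y[2v+1])`. -/
def decodeDrawing (n : ℕ) (y : ℕ → ℝ) (v : Fin n) : Plane :=
  !₂[y (2 * v), y (2 * v + 1)]

/-! ### Segments against concentric spheres in an inner product space. -/

section SegmentGeometry

variable {E : Type*} [NormedAddCommGroup E] [InnerProductSpace ℝ E]

/-! The levels lie on circles whose radii decrease towards 1 but stay above 1, in a very thin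
annulus. Tree edges are short and nearly radial: they stay outside the unit disc, do not return to
the inner circle before their lower end, and lose squared norm at a definite rate. Non-tree edges
are long compared with the thickness of the annulus at their ends. If both ends are on one level,
the separation `d` bounds the length from below; if the levels are consecutive, the lower end is
close to its parent, which shares the level of the upper end but differs from it. Hence a non-tree
edge dips into the unit disc except close to its ends, and there it is nearly tangential
(`nearEnd_of_mem_segment`).

A common point of a tree edge and a non-tree edge is therefore either on or inside the circle of the
lower tree vertex, where strict convexity of the disc leaves only a common end (`tree_nontree`), or
near an end `a` of the non-tree edge. In the latter case, unless `a` is on the lower level of the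
tree edge, separation forces the tree edge to start at `a` or at a descendant of `a`, and steep
against flat leaves only `a` itself (`eq_end_of_nearEnd`). Two tree edges are kept apart by an
intermediate circle, by the separation of their upper ends, or by their directions (`tree_tree`).

Such placements exist with scales `s 0 = 1` and `s (l + 1) = s l ^ 2 / q`: level `l` has radius `1 +
s l ^ 2 / 256`, and a child is shifted from its parent by its own multiple of its scale
(`IsParameterization.isFinePlacement`). Everything is rational in these data, so a real RAM computes
it by field operations during a breadth-first search of the tree; a potential argument bounds the
time (`within_search`). The scales decay at least geometrically with ratio `q`, so a tree with three
vertices on level 1 and a long path has a large triangle next to a tiny edge, and hence exponential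
area (`le_drawingArea_broom`). For the last claim, every vertex picks a neighbour closer to the root
as its parent. -/

theorem norm_sq_convex_comb (a b : E) (s : ℝ) :
    ‖(1 - s) • a + s • b‖ ^ 2 =
      (1 - s) * ‖a‖ ^ 2 + s * ‖b‖ ^ 2 - s * (1 - s) * ‖b - a‖ ^ 2 := by
  rw [norm_add_sq_real, norm_sub_sq_real, norm_smul, norm_smul, real_inner_smul_left,
    real_inner_smul_right, mul_pow, mul_pow, Real.norm_eq_abs, Real.norm_eq_abs, sq_abs, sq_abs,
    real_inner_comm]
  ring

theorem exists_of_mem_segment {a b x : E} (hx : x ∈ segment ℝ a b) :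
    ∃ s : ℝ, 0 ≤ s ∧ s ≤ 1 ∧ x = (1 - s) • a + s • b := by
  obtain ⟨p, s, hp, hs, hps, rfl⟩ := hx
  exact ⟨s, hs, by linarith, by rw [← hps]; simp⟩

theorem convex_comb_sub_left (a b : E) (s : ℝ) : (1 - s) • a + s • b - a = s • (b - a) := by
  module

/-- A point of a segment with ends in a ball about the origin lies in the ball, and on its
boundary only if it is an end. -/
theorem norm_sq_le_of_mem_segment {a b x : E} {R : ℝ} (ha : ‖a‖ ^ 2 ≤ R) (hb : ‖b‖ ^ 2 ≤ R)
    (hx : x ∈ segment ℝ a b) : ‖x‖ ^ 2 ≤ R ∧ (‖x‖ ^ 2 = R → x = a ∨ x = b) := by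
  obtain ⟨s, h0, h1, rfl⟩ := exists_of_mem_segment hx
  rw [norm_sq_convex_comb]
  have h2 : 0 ≤ s * (1 - s) := mul_nonneg h0 (by linarith)
  have h3 := mul_nonneg h2 (sq_nonneg ‖b - a‖)
  refine ⟨by nlinarith, fun h => ?_⟩
  have h4 : s * (1 - s) * ‖b - a‖ ^ 2 = 0 := by nlinarith
  rcases mul_eq_zero.1 h4 with h5 | h5
  · rcases mul_eq_zero.1 h5 with h6 | h6
    · left; simp [h6]
    · right; simp [show s = 1 by linarith]
  · have h6 : b = a := by simpa [sub_eq_zero] using h5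
    left; rw [h6]; module

/-- A short segment between two concentric spheres meets the inner closed ball only in its end. -/
theorem norm_sq_ge_of_mem_segment {u w x : E} (h : ‖w - u‖ ^ 2 < ‖u‖ ^ 2 - ‖w‖ ^ 2)
    (hx : x ∈ segment ℝ u w) : ‖w‖ ^ 2 ≤ ‖x‖ ^ 2 ∧ (‖x‖ ^ 2 = ‖w‖ ^ 2 → x = w) := by
  rw [segment_symm] at hx
  obtain ⟨s, h0, h1, rfl⟩ := exists_of_mem_segment hx
  rw [norm_sq_convex_comb, norm_sub_rev u w]
  have e : (1 - s) * ‖w‖ ^ 2 + s * ‖u‖ ^ 2 - s * (1 - s) * ‖w - u‖ ^ 2 =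
    ‖w‖ ^ 2 + s * ((‖u‖ ^ 2 - ‖w‖ ^ 2) - (1 - s) * ‖w - u‖ ^ 2) := by ring
  have hp : 0 < (‖u‖ ^ 2 - ‖w‖ ^ 2) - (1 - s) * ‖w - u‖ ^ 2 := by
    -- The hypothesis `h` says that the inner product of `w` and `u - w` is positive, so the segment
    -- leaves the ball at `w`.
    nlinarith [sq_nonneg ‖w - u‖]
  rw [e]
  refine ⟨by nlinarith [mul_nonneg h0 hp.le], fun h => ?_⟩
  have : s = 0 := by
    by_contra hne
    have := mul_pos (lt_of_le_of_ne h0 (Ne.symm hne)) hp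
    linarith
  simp [this]

/-- Along a short segment descending between two concentric spheres, the distance to the
origin drops at a definite rate. -/
theorem norm_sq_drop_of_mem_segment {u w x : E} {l : ℝ} (hl : ‖w - u‖ ≤ l)
    (h : l / 2 < ‖u‖ ^ 2 - ‖w‖ ^ 2) (hx : x ∈ segment ℝ u w)
    (hflat : ‖u‖ ^ 2 - ‖x - u‖ / 4 ≤ ‖x‖ ^ 2) : x = u := by
  obtain ⟨s, h0, h1, rfl⟩ := exists_of_mem_segment hx
  rw [convex_comb_sub_left, norm_smul, Real.norm_of_nonneg h0, norm_sq_convex_comb] at hflat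
  have h3 : 0 ≤ s * (1 - s) * ‖w - u‖ ^ 2 := by
    have : 0 ≤ 1 - s := by linarith
    positivity
  have : s = 0 := by
    -- Squared norm is convex along the segment, so it drops by more than `s * l / 2`, whereas
    -- `hflat` allows at most `s * l / 4`.
    by_contra hne
    have hs : 0 < s := lt_of_le_of_ne h0 (Ne.symm hne)
    have : s * ‖w - u‖ ≤ s * l := by gcongr
    have hl0 : 0 ≤ l := (norm_nonneg _).trans hl
    nlinarith
  simp [this]

/-- `x` lies close to `a`, in the ball through `a`, and the path from `a` to `x` is flat. -/
structure NearEnd (d : ℝ) (a x : E) : Prop where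
  dist_le : ‖x - a‖ ≤ d / 8
  flat : ‖a‖ ^ 2 - ‖x - a‖ / 4 ≤ ‖x‖ ^ 2
  le : ‖x‖ ^ 2 ≤ ‖a‖ ^ 2
  eq : ‖x‖ ^ 2 = ‖a‖ ^ 2 → x = a

/-- With `M` the length of the segment, `1 ≤ ‖x‖ ^ 2` forces `s * M ^ 2 ≤ 4 * α` on the half next to
`a`. Since `d / 2 ≤ M` and `64 * α ≤ d ^ 2`, the distance `s * M` from `a` is at most `d / 8`. The
drop in squared norm is at most `17 / 16 * s * M ^ 2`, which is below `s * M / 4` because `M < 1 /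
8`. -/
theorem nearEnd_of_le_half {a b : E} {s α β d : ℝ} (h0 : 0 ≤ s) (h1 : s ≤ 1 / 2)
    (ha : ‖a‖ ^ 2 = 1 + α) (hb : ‖b‖ ^ 2 = 1 + β) (hα : 0 < α) (hβ : 0 < β)
    (hαL : 16 * α ≤ ‖b - a‖ ^ 2) (hβL : 16 * β ≤ ‖b - a‖ ^ 2)
    (hL : ‖b - a‖ < 1 / 8) (hd : 0 < d) (hαd : 64 * α ≤ d ^ 2) (hdL : d ≤ 2 * ‖b - a‖)
    (hx : 1 ≤ ‖(1 - s) • a + s • b‖ ^ 2) : NearEnd d a ((1 - s) • a + s • b) := by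
  have e := norm_sq_convex_comb a b s
  have ed : ‖(1 - s) • a + s • b - a‖ = s * ‖b - a‖ := by
    rw [convex_comb_sub_left, norm_smul, Real.norm_of_nonneg h0]
  set x := (1 - s) • a + s • b with hxdef
  set M := ‖b - a‖ with hM
  have hM0 : 0 < M := by linarith
  rw [ha, hb] at e
  have hsM : 0 ≤ s * M ^ 2 := by positivity
  have k1 : s * (M ^ 2 / 2) ≤ s * (1 - s) * M ^ 2 := by nlinarith
  have k2 : s * β ≤ s * (M ^ 2 / 16) := by gcongr; linarith
  have k3 : 0 ≤ s * α := by positivity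
  have k4 : s * M ^ 2 ≤ 4 * α := by nlinarith
  refine ⟨?_, ?_, ?_, ?_⟩
  · rw [ed]
    by_contra hc
    push Not at hc
    have : d / 8 * (d / 2) ≤ d / 8 * M := by gcongr; linarith
    have : d / 8 * M < s * M * M := by gcongr
    nlinarith
  · rw [ed, ha, e]
    have k5 : s * α ≤ s * (M ^ 2 / 16) := by gcongr; linarith
    have k6 : s * M * M ≤ s * M * (1 / 8) := by gcongr
    have k7 : s * (1 - s) * M ^ 2 ≤ s * M ^ 2 := by nlinarith [mul_nonneg h0 hsM]
    have k8 : 0 ≤ s * β := by positivity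
    nlinarith
  · rw [ha, e]; nlinarith
  · rw [ha, e]
    intro h
    have : s * M ^ 2 = 0 := by nlinarith
    have : s = 0 := by
      rcases mul_eq_zero.1 this with h | h
      · exact h
      · exact absurd h (by positivity)
    simp [hxdef, this]

theorem nearEnd_of_mem_segment {a b x : E} {α β d e : ℝ}
    (ha : ‖a‖ ^ 2 = 1 + α) (hb : ‖b‖ ^ 2 = 1 + β) (hα : 0 < α) (hβ : 0 < β)
    (hL : ‖b - a‖ < 1 / 8) (hd : 0 < d) (he : 0 < e)
    (hαd : 64 * α ≤ d ^ 2) (hβe : 64 * β ≤ e ^ 2)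
    (hdL : d ≤ 2 * ‖b - a‖) (heL : e ≤ 2 * ‖b - a‖)
    (hx : x ∈ segment ℝ a b) (h1 : 1 ≤ ‖x‖ ^ 2) : NearEnd d a x ∨ NearEnd e b x := by
  have hαL : 16 * α ≤ ‖b - a‖ ^ 2 := by nlinarith
  have hβL : 16 * β ≤ ‖b - a‖ ^ 2 := by nlinarith
  obtain ⟨s, h0, hs1, rfl⟩ := exists_of_mem_segment hx
  rcases le_total s (1 / 2) with h | h
  · exact .inl (nearEnd_of_le_half h0 h ha hb hα hβ hαL hβL hL hd hαd hdL h1)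
  · right
    have e : (1 - s) • a + s • b = (1 - (1 - s)) • b + (1 - s) • a := by module
    rw [e] at h1 ⊢
    rw [norm_sub_rev] at hαL hβL hL heL
    exact nearEnd_of_le_half (by linarith) (by linarith) hb ha hβ hα hβL hαL hL he hβe heL h1

end SegmentGeometry

/-! ### Fine placements on nested circles and their compatibility. -/

section LevelledPlacement

variable {V : Type u}

theorem SimpleGraph.Connected.exists_adj_dist_of_dist_succ {G : SimpleGraph V} (hG : G.Connected)
    {root v : V} {k : ℕ} (h : G.dist root v = k + 1) :
    ∃ p, G.Adj p v ∧ G.dist root p = k := by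
  obtain ⟨w, hw⟩ := hG.exists_walk_length_eq_dist v root
  rw [SimpleGraph.dist_comm, h] at hw
  cases w with
  | nil => simp at hw
  | cons hadj w' =>
    rename_i p
    have h1 : w'.length = k := by simpa using hw
    refine ⟨p, hadj.symm, le_antisymm ?_ ?_⟩
    · rw [SimpleGraph.dist_comm, ← h1]; exact SimpleGraph.dist_le w'
    · have h2 := hG.dist_triangle (u := root) (v := p) (w := v)
      have : G.dist p v = 1 := SimpleGraph.dist_eq_one_iff_adj.2 hadj.symm
      omega

/-- A placement of the vertices on nested circles that is fine enough, level by level, to give a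
compatible drawing: `lev` is the level, `1 + σ l` the squared radius of level `l`, `d l` a lower
bound for distances on level `l`, and `len l` an upper bound for the tree edges below level `l`. -/
structure IsFinePlacement (S : SimpleGraph V) (root : V) (Γ : V → Plane) (σ d len : ℕ → ℝ) :
    Prop where
  norm_sq : ∀ v, ‖Γ v‖ ^ 2 = 1 + σ (S.dist root v)
  pos : ∀ l, 0 < σ l
  d_pos : ∀ l, 0 < d l
  anti : ∀ l, σ (l + 1) < σ l
  d_anti : ∀ l, d (l + 1) ≤ d l
  len_half : ∀ l, len (l + 1) ≤ len l / 2
  len_nonneg : ∀ l, 0 ≤ len l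
  len_le : ∀ l, 8 * len l ≤ d l
  σ_le : ∀ l, 64 * σ l ≤ d l ^ 2
  sq_len_lt : ∀ l, len l ^ 2 < σ l - σ (l + 1)
  len_lt : ∀ l, len l / 2 < σ l - σ (l + 1)
  diam : ∀ a b, ‖Γ b - Γ a‖ < 1 / 8
  sep : ∀ a b, a ≠ b → S.dist root a = S.dist root b → d (S.dist root a) ≤ ‖Γ b - Γ a‖
  edge : ∀ a b, S.Adj a b → S.dist root b = S.dist root a + 1 →
    ‖Γ b - Γ a‖ ≤ len (S.dist root a)

namespace IsFinePlacement

variable {G S : SimpleGraph V} {root : V} {Γ : V → Plane} {σ d len : ℕ → ℝ}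

theorem σ_strictAnti (h : IsFinePlacement S root Γ σ d len) : StrictAnti σ :=
  strictAnti_nat_of_succ_lt h.anti

theorem d_antitone (h : IsFinePlacement S root Γ σ d len) : Antitone d :=
  antitone_nat_of_succ_le h.d_anti

theorem injective (h : IsFinePlacement S root Γ σ d len) : Function.Injective Γ := by
  intro a b hab
  by_contra hne
  have h1 := h.norm_sq a
  have h2 := h.norm_sq b
  rw [hab, h2] at h1
  have h3 : S.dist root a = S.dist root b := h.σ_strictAnti.injective (by linarith)
  have h4 := h.sep a b hne h3
  have h5 := h.d_pos (S.dist root a)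
  simp [hab] at h4
  linarith

/-- The bounds on edge lengths at least halve from level to level, so the path up to the ancestor
telescopes against `2 * len`. -/
theorem exists_ancestor (h : IsFinePlacement S root Γ σ d len) (hS : S.Connected) (j k : ℕ) :
    ∀ v, S.dist root v = j + k → ∃ a, S.dist root a = j ∧
      ‖Γ v - Γ a‖ ≤ 2 * len j - 2 * len (j + k) ∧ (k = 0 → a = v) := by
  induction k with
  | zero => intro v hv; exact ⟨v, hv, by simp, fun _ => rfl⟩
  | succ k ih =>
    intro v hv
    obtain ⟨p, hp, hpl⟩ := hS.exists_adj_dist_of_dist_succ (k := j + k) (by rw [hv]; ring)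
    obtain ⟨a, ha, had, -⟩ := ih p hpl
    refine ⟨a, ha, ?_, by simp⟩
    have h1 := h.edge p v hp (by omega)
    rw [hpl] at h1
    have h2 := h.len_half (j + k)
    have h3 : ‖Γ v - Γ a‖ ≤ ‖Γ v - Γ p‖ + ‖Γ p - Γ a‖ := norm_sub_le_norm_sub_add_norm_sub _ _ _
    rw [← add_assoc]
    linarith

/-- Tree edges meet only in common ends. -/
theorem tree_tree (h : IsFinePlacement S root Γ σ d len) {u w a b : V}
    (huw : S.Adj u w) (hw : S.dist root w = S.dist root u + 1)
    (hab : S.Adj a b) (hb : S.dist root b = S.dist root a + 1)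
    (hle : S.dist root a ≤ S.dist root u) (hne : ¬ (u = a ∧ w = b)) {x : Plane}
    (hx : x ∈ segment ℝ (Γ u) (Γ w)) (hx' : x ∈ segment ℝ (Γ a) (Γ b)) :
    (x = Γ u ∧ u = a) ∨ (x = Γ u ∧ u = b) := by
  have key : ∀ u w : V, S.Adj u w → S.dist root w = S.dist root u + 1 →
      ‖Γ w - Γ u‖ ^ 2 < ‖Γ u‖ ^ 2 - ‖Γ w‖ ^ 2 := by
    intro u w huw hw
    have h1 := h.edge u w huw hw
    rw [h.norm_sq, h.norm_sq, hw]
    have h2 := h.sq_len_lt (S.dist root u)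
    have := norm_nonneg (Γ w - Γ u)
    nlinarith
  have low := norm_sq_ge_of_mem_segment (key a b hab hb) hx'
  have lowu := norm_sq_ge_of_mem_segment (key u w huw hw) hx
  have hup := norm_sq_le_of_mem_segment (R := ‖Γ u‖ ^ 2) le_rfl
    (by rw [h.norm_sq, h.norm_sq, hw]; linarith [h.anti (S.dist root u)]) hx
  rcases hle.lt_or_eq with hlt | heq
  -- The edge `uw` lies in the disc through `u` and `ab` outside the circle of `b`, which is not
  -- smaller; strictness on both sides leaves only `u = b`.
  · right
    have h1 : ‖Γ u‖ ^ 2 ≤ ‖Γ b‖ ^ 2 := by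
      rw [h.norm_sq, h.norm_sq, hb]
      have := h.σ_strictAnti.antitone (show S.dist root a + 1 ≤ S.dist root u by omega)
      linarith
    have h2 := low.2 (le_antisymm (hup.1.trans h1) low.1)
    have h3 := hup.2 (le_antisymm hup.1 (h1.trans low.1))
    rcases h3 with h3 | h3
    · exact ⟨h3, h.injective (h3.symm.trans h2)⟩
    · exfalso
      have := h.injective (h3.symm.trans h2)
      rw [this] at hw
      have h4 : ‖Γ b‖ ^ 2 < ‖Γ u‖ ^ 2 := by
        rw [h.norm_sq, h.norm_sq, hw]; linarith [h.anti (S.dist root u)]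
      linarith
  · left
    -- Both edges are at most an eighth of the separation of their level, too short to meet from
    -- distinct upper ends.
    have hua : u = a := by
      by_contra hua
      have h1 := h.sep u a hua heq.symm
      have h2 : ‖x - Γ u‖ ≤ len (S.dist root u) := by
        obtain ⟨s, h0, h1, rfl⟩ := exists_of_mem_segment hx
        rw [convex_comb_sub_left, norm_smul, Real.norm_of_nonneg h0]
        exact (mul_le_of_le_one_left (norm_nonneg _) h1).trans (h.edge u w huw hw)
      have h3 : ‖x - Γ a‖ ≤ len (S.dist root u) := by
        obtain ⟨s, h0, h1, rfl⟩ := exists_of_mem_segment hx'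
        rw [convex_comb_sub_left, norm_smul, Real.norm_of_nonneg h0, ← heq]
        exact (mul_le_of_le_one_left (norm_nonneg _) h1).trans (h.edge a b hab hb)
      have h4 : ‖Γ a - Γ u‖ ≤ ‖x - Γ u‖ + ‖x - Γ a‖ := by
        rw [norm_sub_rev x (Γ a), add_comm]
        exact norm_sub_le_norm_sub_add_norm_sub _ _ _
      have h5 := h.len_le (S.dist root u)
      have h6 := h.d_pos (S.dist root u)
      linarith
    subst hua
    refine ⟨?_, rfl⟩
    by_contra hxu
    have hwb : w ≠ b := fun e => hne ⟨rfl, e⟩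
    have hnn : ‖Γ w‖ ^ 2 = ‖Γ b‖ ^ 2 := by rw [h.norm_sq, h.norm_sq, hw, hb]
    -- Both edges now run along one ray from `u`. The lower end of the shorter one lies on the
    -- longer one, at the norm of its lower end, so the lower ends coincide.
    obtain ⟨s, hs0, hs1, hs⟩ := exists_of_mem_segment hx
    obtain ⟨r, hr0, hr1, hr⟩ := exists_of_mem_segment hx'
    have hs0' : 0 < s := lt_of_le_of_ne hs0 (fun e => hxu (by rw [hs, ← e]; simp))
    have hr0' : 0 < r := lt_of_le_of_ne hr0 (fun e => hxu (by rw [hr, ← e]; simp))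
    have hdir : s • (Γ w - Γ u) = r • (Γ b - Γ u) := by
      rw [← convex_comb_sub_left, ← convex_comb_sub_left, ← hs, ← hr]
    rcases le_total s r with hsr | hrs
    · have e : Γ b = (1 - s / r) • Γ u + (s / r) • Γ w := by
        have : Γ b - Γ u = (s / r) • (Γ w - Γ u) := by
          rw [div_eq_inv_mul, mul_smul, hdir, smul_smul, inv_mul_cancel₀ hr0'.ne', one_smul]
        rw [← convex_comb_sub_left] at this
        simpa using this
      have hmem : Γ b ∈ segment ℝ (Γ u) (Γ w) :=
        ⟨1 - s / r, s / r, by rw [sub_nonneg]; exact (div_le_one hr0').2 hsr, by positivity,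
          by ring, e.symm⟩
      exact hwb (h.injective ((norm_sq_ge_of_mem_segment (key u w huw hw) hmem).2 hnn.symm)).symm
    · have e : Γ w = (1 - r / s) • Γ u + (r / s) • Γ b := by
        have : Γ w - Γ u = (r / s) • (Γ b - Γ u) := by
          rw [div_eq_inv_mul, mul_smul, ← hdir, smul_smul, inv_mul_cancel₀ hs0'.ne', one_smul]
        rw [← convex_comb_sub_left] at this
        simpa using this
      have hmem : Γ w ∈ segment ℝ (Γ u) (Γ b) :=
        ⟨1 - r / s, r / s, by rw [sub_nonneg]; exact (div_le_one hs0').2 hrs, by positivity,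
          by ring, e.symm⟩
      exact hwb (h.injective ((norm_sq_ge_of_mem_segment (key u b hab hb) hmem).2 hnn))

/-- A point of a tree edge `uw` that is near an end `a` of another edge, with `a` at most one level
below `u`, is a common end of the two edges. -/
theorem eq_end_of_nearEnd (h : IsFinePlacement S root Γ σ d len) (hS : S.Connected) {u w a : V}
    (huw : S.Adj u w) (hw : S.dist root w = S.dist root u + 1)
    (hle : S.dist root a ≤ S.dist root u + 1) {x : Plane}
    (hx : x ∈ segment ℝ (Γ u) (Γ w)) (hn : NearEnd (d (S.dist root a)) (Γ a) x) :
    x = Γ a ∧ (a = u ∨ a = w) := by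
  have hlen := h.edge u w huw hw
  have hnu := h.norm_sq u
  have hnw := h.norm_sq w
  rw [hw] at hnw
  have hlow := norm_sq_ge_of_mem_segment (u := Γ u) (w := Γ w) (by
    rw [hnu, hnw]
    have h2 := h.sq_len_lt (S.dist root u)
    have := norm_nonneg (Γ w - Γ u)
    nlinarith) hx
  rcases hle.lt_or_eq with hlt | heq
  · obtain ⟨k, hk⟩ := Nat.exists_eq_add_of_le (show S.dist root a ≤ S.dist root u by omega)
    -- The ancestor `u'` of `u` on the level of `a` is within `d / 4` of `x`, and `a` is within `d /
    -- 8`, so separation identifies them.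
    obtain ⟨u', hu', hd', hk0⟩ := h.exists_ancestor hS _ k u hk
    have hxu : ‖x - Γ u‖ ≤ len (S.dist root u) := by
      obtain ⟨s, h0, h1, rfl⟩ := exists_of_mem_segment hx
      rw [convex_comb_sub_left, norm_smul, Real.norm_of_nonneg h0]
      exact (mul_le_of_le_one_left (norm_nonneg _) h1).trans hlen
    have h3 : ‖x - Γ u'‖ ≤ ‖x - Γ u‖ + ‖Γ u - Γ u'‖ := norm_sub_le_norm_sub_add_norm_sub _ _ _
    have hl0 := h.len_nonneg (S.dist root u)
    rw [← hk] at hd'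
    have h4 : ‖x - Γ u'‖ ≤ 2 * len (S.dist root a) := by linarith
    have hua : u' = a := by
      by_contra hne
      have h5 := h.sep u' a hne hu'
      rw [hu'] at h5
      have h6 : ‖Γ a - Γ u'‖ ≤ ‖Γ a - x‖ + ‖x - Γ u'‖ := norm_sub_le_norm_sub_add_norm_sub _ _ _
      rw [norm_sub_rev (Γ a) x] at h6
      have h7 := hn.dist_le
      have h8 := h.len_le (S.dist root a)
      have h9 := h.d_pos (S.dist root a)
      linarith
    subst hua
    rcases Nat.eq_zero_or_pos k with hk1 | hk1
    · have := hk0 hk1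
      subst this
      have hx1 := norm_sq_drop_of_mem_segment hlen
        (by rw [hnu, hnw]; linarith [h.len_lt (S.dist root u')]) hx hn.flat
      exact ⟨hx1, .inl rfl⟩
    -- Here `x` is at least one level below `a`, hence lower by more than `len / 2`; but `x` is
    -- within `2 * len` of `a`, so flatness allows a drop of at most `len / 2`.
    · exfalso
      have hup := (norm_sq_le_of_mem_segment (R := ‖Γ u‖ ^ 2) le_rfl
        (by rw [hnu, hnw]; linarith [h.anti (S.dist root u)]) hx).1
      have h5 := hn.flat
      have h6 := h.len_lt (S.dist root u')
      rw [h.norm_sq] at h5 hup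
      have h7 := h.σ_strictAnti.antitone (show S.dist root u' + 1 ≤ S.dist root u by omega)
      linarith
  -- Now `a` and `w` share a circle: the non-tree side puts `x` in its disc, and the tree edge meets
  -- that disc only in `w`.
  · have hnn : ‖Γ a‖ ^ 2 = ‖Γ w‖ ^ 2 := by rw [h.norm_sq, hnw, heq]
    have hxw : ‖x‖ ^ 2 = ‖Γ w‖ ^ 2 := le_antisymm (hnn ▸ hn.le) hlow.1
    have h1 := hlow.2 hxw
    have h2 := hn.eq (hxw.trans hnn.symm)
    exact ⟨h2, .inr (h.injective (h2.symm.trans h1))⟩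

/-- A tree edge and an edge that is not in the tree meet only in common ends. -/
theorem tree_nontree (h : IsFinePlacement S root Γ σ d len) (hS : S.Connected) {u w a b : V}
    (huw : S.Adj u w) (hw : S.dist root w = S.dist root u + 1)
    (hab : ¬ S.Adj a b) (hne : a ≠ b)
    (hlev : S.dist root a = S.dist root b ∨ S.dist root b = S.dist root a + 1) {x : Plane}
    (hx : x ∈ segment ℝ (Γ u) (Γ w)) (hx' : x ∈ segment ℝ (Γ a) (Γ b)) :
    ∃ v, x = Γ v ∧ (v = u ∨ v = w) ∧ (v = a ∨ v = b) := by
  have hlen := h.edge u w huw hw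
  have hnu := h.norm_sq u
  have hnw := h.norm_sq w
  rw [hw] at hnw
  have hlow := norm_sq_ge_of_mem_segment (u := Γ u) (w := Γ w) (by
    rw [hnu, hnw]
    have h2 := h.sq_len_lt (S.dist root u)
    have := norm_nonneg (Γ w - Γ u)
    nlinarith) hx
  by_cases hdeep : S.dist root u + 1 ≤ S.dist root a
  -- The chord `ab` lies in the disc through `w` and the tree edge outside its interior.
  · have hRa : ‖Γ a‖ ^ 2 ≤ ‖Γ w‖ ^ 2 := by
      rw [h.norm_sq, hnw]; linarith [h.σ_strictAnti.antitone hdeep]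
    have hRb : ‖Γ b‖ ^ 2 ≤ ‖Γ w‖ ^ 2 := by
      rw [h.norm_sq, hnw]
      linarith [h.σ_strictAnti.antitone (show S.dist root u + 1 ≤ S.dist root b by omega)]
    have h1 := norm_sq_le_of_mem_segment hRa hRb hx'
    have h2 := le_antisymm h1.1 hlow.1
    have h3 := hlow.2 h2
    rcases h1.2 h2 with h4 | h4
    · exact ⟨w, h3, .inr rfl, .inl (h.injective (h3.symm.trans h4))⟩
    · exact ⟨w, h3, .inr rfl, .inr (h.injective (h3.symm.trans h4))⟩
  · have hL : d (S.dist root a) ≤ 2 * ‖Γ b - Γ a‖ := by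
      have hdp := h.d_pos (S.dist root a)
      rcases hlev with he | hb
      · have := h.sep a b hne he
        linarith
      · obtain ⟨p, hp, hpl⟩ := hS.exists_adj_dist_of_dist_succ hb
        -- The parent `p` of `b` is at distance at least `d` from `a` and at most `d / 8` from `b`.
        have hpa : a ≠ p := fun e => hab (e ▸ hp)
        have h1 := h.sep a p hpa hpl.symm
        have h2 := h.edge p b hp (by omega)
        rw [hpl] at h2
        have h3 := h.len_le (S.dist root a)
        have h4 : ‖Γ p - Γ a‖ ≤ ‖Γ b - Γ p‖ + ‖Γ b - Γ a‖ := by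
          rw [norm_sub_rev (Γ b) (Γ p)]
          exact norm_sub_le_norm_sub_add_norm_sub _ _ _
        linarith
    have hL' : d (S.dist root b) ≤ 2 * ‖Γ b - Γ a‖ :=
      (h.d_antitone (by omega : S.dist root a ≤ S.dist root b)).trans hL
    have h1 : 1 ≤ ‖x‖ ^ 2 := by
      have := h.pos (S.dist root u + 1)
      linarith [hlow.1]
    rcases nearEnd_of_mem_segment (h.norm_sq a) (h.norm_sq b) (h.pos _) (h.pos _) (h.diam a b)
      (h.d_pos _) (h.d_pos _) (h.σ_le _) (h.σ_le _) hL hL' hx' h1 with hn | hn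
    · obtain ⟨h2, h3⟩ := h.eq_end_of_nearEnd hS huw hw (by omega) hx hn
      exact ⟨a, h2, h3, .inl rfl⟩
    · obtain ⟨h2, h3⟩ := h.eq_end_of_nearEnd hS huw hw (by omega) hx hn
      exact ⟨b, h2, h3, .inr rfl⟩

theorem exists_common_end (h : IsFinePlacement S root Γ σ d len) (hT : IsBFSTree G S root)
    {a b c e : V} (hab : S.Adj a b) (hce : G.Adj c e) (hne : s(a, b) ≠ s(c, e)) {x : Plane}
    (hx : x ∈ segment ℝ (Γ a) (Γ b)) (hx' : x ∈ segment ℝ (Γ c) (Γ e)) :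
    ∃ v, x = Γ v ∧ (v = a ∨ v = b) ∧ (v = c ∨ v = e) := by
  wlog hlab : S.dist root b = S.dist root a + 1 generalizing a b
  · have hd := hT.isTree.dist_eq_dist_add_one_of_adj root hab
    obtain ⟨v, h1, h2, h3⟩ := this hab.symm (by rwa [Sym2.eq_swap])
      (by rwa [segment_symm]) (by omega)
    exact ⟨v, h1, h2.symm, h3⟩
  by_cases hS : S.Adj c e
  · wlog hlce : S.dist root e = S.dist root c + 1 generalizing c e
    · have hd := hT.isTree.dist_eq_dist_add_one_of_adj root hS
      obtain ⟨v, h1, h2, h3⟩ := this hce.symm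
        (by rwa [segment_symm]) (by rwa [Sym2.eq_swap (a := e)]) hS.symm (by omega)
      exact ⟨v, h1, h2, h3.symm⟩
    have hne' : ¬ (a = c ∧ b = e) := fun ⟨h1, h2⟩ => hne (by rw [h1, h2])
    rcases le_total (S.dist root c) (S.dist root a) with hle | hle
    · rcases h.tree_tree hab hlab hS hlce hle hne' hx hx' with ⟨h1, h2⟩ | ⟨h1, h2⟩
      · exact ⟨a, h1, .inl rfl, .inl h2⟩
      · exact ⟨a, h1, .inl rfl, .inr h2⟩
    · rcases h.tree_tree hS hlce hab hlab hle (fun ⟨h1, h2⟩ => hne' ⟨h1.symm, h2.symm⟩) hx' hx with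
        ⟨h1, h2⟩ | ⟨h1, h2⟩
      · exact ⟨c, h1, .inl h2, .inl rfl⟩
      · exact ⟨c, h1, .inr h2, .inl rfl⟩
  · rcases hT.levels c e hce hS with hl | hl | hl
    · exact h.tree_nontree hT.isTree.connected hab hlab hS hce.ne (.inl hl) hx hx'
    · obtain ⟨v, h1, h2, h3⟩ := h.tree_nontree hT.isTree.connected hab hlab
        (fun h => hS h.symm) hce.ne.symm (.inr hl) hx (by rwa [segment_symm])
      exact ⟨v, h1, h2, h3.symm⟩
    · exact h.tree_nontree hT.isTree.connected hab hlab hS hce.ne (.inr hl) hx hx'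

/-- That no edge passes through a vertex `w` also follows from `exists_common_end`: `w` is an end of
some tree edge, and this differs from any edge that does not end in `w`. -/
theorem isCompatibleDrawing (h : IsFinePlacement S root Γ σ d len) (hT : IsBFSTree G S root) :
    IsCompatibleDrawing G S Γ where
  drawing :=
    { injective := h.injective
      not_mem_edge := by
        intro a b w hab hwa hwb hmem
        have hnt : Nontrivial V := ⟨w, a, hwa⟩
        obtain ⟨z, hz⟩ := hT.isTree.connected.preconnected.exists_adj_of_nontrivial w
        obtain ⟨v, h1, -, h3⟩ := h.exists_common_end hT hz hab
          (by
            intro he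
            rcases Sym2.eq_iff.1 he with ⟨h1, -⟩ | ⟨h1, -⟩
            · exact hwa h1
            · exact hwb h1)
          (left_mem_segment ℝ _ _) hmem
        have := h.injective h1
        subst this
        exact h3.elim hwa hwb }
  not_crossed := by
    rintro a b c e hab hce hne x ⟨hx, hx'⟩
    obtain ⟨v, h1, h2, h3⟩ := h.exists_common_end hT hab hce hne hx hx'
    exact ⟨v, ⟨h2, h3⟩, h1.symm⟩

theorem levelsOnNestedCircles (h : IsFinePlacement S root Γ σ d len) :
    LevelsOnNestedCircles S root Γ := by
  refine ⟨0, fun l => √(1 + σ l), fun i j hij => ?_, fun l => ?_, fun v => ?_⟩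
  · have h1 := h.σ_strictAnti hij
    have h2 := h.pos j
    exact Real.sqrt_lt_sqrt (by linarith) (by linarith)
  · have h2 := h.pos l
    exact Real.sqrt_pos.2 (by linarith)
  · simp only [dist_zero_right]; rw [← h.norm_sq, Real.sqrt_sq (norm_nonneg _)]

end IsFinePlacement

end LevelledPlacement

/-! ### Rational points of circles and the recursive choice of scales. -/

section CirclePlacement

/-- The point of the circle of radius `r` about the origin with rational parameter `t`. -/
noncomputable def circlePoint (r t : ℝ) : Plane :=
  !₂[r * (2 * t / (1 + t ^ 2)), r * ((1 - t ^ 2) / (1 + t ^ 2))]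

theorem norm_sq_circlePoint (r t : ℝ) : ‖circlePoint r t‖ ^ 2 = r ^ 2 := by
  have : 1 + t ^ 2 ≠ 0 := by positivity
  simp only [circlePoint, EuclideanSpace.norm_sq_eq, Fin.sum_univ_two, Real.norm_eq_abs, sq_abs]
  simp
  field_simp
  ring

theorem norm_sq_circlePoint_sub (r r' s t : ℝ) :
    ‖circlePoint r s - circlePoint r' t‖ ^ 2 =
      (r - r') ^ 2 + r * r' * (4 * (s - t) ^ 2 / ((1 + s ^ 2) * (1 + t ^ 2))) := by
  have h1 : 1 + t ^ 2 ≠ 0 := by positivity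
  have h2 : 1 + s ^ 2 ≠ 0 := by positivity
  simp only [circlePoint, EuclideanSpace.norm_sq_eq, Fin.sum_univ_two, Real.norm_eq_abs, sq_abs]
  simp
  field_simp
  ring

/-- Parameters in `[-1, 1]` make the denominator at most 4, so distances on one circle dominate
parameter differences. -/
theorem le_norm_circlePoint_sub {r s t : ℝ} (hr : 1 ≤ r) (hs : |s| ≤ 1) (ht : |t| ≤ 1) :
    |s - t| ≤ ‖circlePoint r s - circlePoint r t‖ := by
  rw [← sq_le_sq₀ (abs_nonneg _) (norm_nonneg _), norm_sq_circlePoint_sub, sq_abs]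
  have h1 : s ^ 2 ≤ 1 := (sq_le_one_iff_abs_le_one s).2 hs
  have h2 : t ^ 2 ≤ 1 := (sq_le_one_iff_abs_le_one t).2 ht
  have h3 : (1 + s ^ 2) * (1 + t ^ 2) ≤ 4 := by nlinarith [sq_nonneg s, sq_nonneg t]
  have h4 : (s - t) ^ 2 ≤ 4 * (s - t) ^ 2 / ((1 + s ^ 2) * (1 + t ^ 2)) := by
    rw [le_div_iff₀ (by positivity)]
    nlinarith [sq_nonneg (s - t)]
  nlinarith [sq_nonneg (s - t), mul_le_mul hr hr zero_le_one (by linarith)]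

theorem norm_circlePoint_sub_le {r r' : ℝ} (s t : ℝ) (h0 : 0 ≤ r) (hr : r ≤ 2)
    (hr' : r' ≤ 2) : ‖circlePoint r s - circlePoint r' t‖ ≤ |r - r'| + 4 * |s - t| := by
  rw [← sq_le_sq₀ (norm_nonneg _) (by positivity), norm_sq_circlePoint_sub]
  have h3 : 1 ≤ (1 + s ^ 2) * (1 + t ^ 2) := by
    nlinarith [sq_nonneg s, sq_nonneg t, mul_nonneg (sq_nonneg s) (sq_nonneg t)]
  have h4 : 4 * (s - t) ^ 2 / ((1 + s ^ 2) * (1 + t ^ 2)) ≤ 4 * (s - t) ^ 2 :=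
    div_le_self (by positivity) h3
  have h5 : r * r' ≤ 4 := by nlinarith
  have h6 : r * r' * (4 * (s - t) ^ 2 / ((1 + s ^ 2) * (1 + t ^ 2))) ≤ 4 * (4 * (s - t) ^ 2) := by
    gcongr
  have h7 := sq_abs (r - r')
  have h8 := sq_abs (s - t)
  nlinarith [mul_nonneg (abs_nonneg (r - r')) (abs_nonneg (s - t))]

/-- The separation of the parameters on level `l`. -/
noncomputable def levelScale (q : ℝ) : ℕ → ℝ
  | 0 => 1
  | l + 1 => levelScale q l ^ 2 / q

theorem levelScale_pos {q : ℝ} (hq : 0 < q) (l : ℕ) : 0 < levelScale q l := by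
  induction l with
  | zero => exact one_pos
  | succ l ih => exact div_pos (pow_pos ih 2) hq

theorem levelScale_le_one {q : ℝ} (hq : 1 ≤ q) (l : ℕ) : levelScale q l ≤ 1 := by
  induction l with
  | zero => exact le_rfl
  | succ l ih =>
    have h0 := levelScale_pos (by linarith : 0 < q) l
    rw [levelScale, div_le_one (by linarith)]
    nlinarith

theorem levelScale_succ_mul_le {q : ℝ} (hq : 1 ≤ q) (l : ℕ) :
    q * levelScale q (l + 1) ≤ levelScale q l := by
  have h0 := levelScale_pos (by linarith : 0 < q) l
  have h1 := levelScale_le_one hq l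
  rw [levelScale, mul_div_cancel₀ _ (by linarith)]
  nlinarith

variable {V : Type u}

/-- Parameters of the vertices on their circles: the parameter of a child exceeds that of its
parent by a multiple of the scale of its level, with multipliers at distance at least `1`. -/
structure IsParameterization (S : SimpleGraph V) (root : V) (N q : ℝ) (f t : V → ℝ) : Prop where
  one_le : ∀ v, 1 ≤ f v
  le : ∀ v, f v ≤ N
  sep : ∀ v w, v ≠ w → 1 ≤ |f v - f w|
  le_q : 1024 * (N + 1) ≤ q
  root_eq : t root = 0
  child_eq : ∀ u w, S.Adj u w → S.dist root w = S.dist root u + 1 →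
    t w = t u + f w * levelScale q (S.dist root w)

/-- The drawing given by parameters of the vertices. -/
noncomputable def placement (S : SimpleGraph V) (root : V) (q : ℝ) (t : V → ℝ) (v : V) : Plane :=
  circlePoint (1 + levelScale q (S.dist root v) ^ 2 / 256) (t v)

namespace IsParameterization

variable {S : SimpleGraph V} {root : V} {N q : ℝ} {f t : V → ℝ}

theorem one_le_N (h : IsParameterization S root N q f t) : 1 ≤ N :=
  (h.one_le root).trans (h.le root)

theorem q_ge (h : IsParameterization S root N q f t) : 2048 ≤ q := by
  linarith [h.one_le_N, h.le_q]

/-- The shifts along a path from the root form a series that decays at least geometrically with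
ratio 1/2; the subtracted term makes the bound telescope. -/
theorem t_bounds (h : IsParameterization S root N q f t) (hS : S.Connected) (l : ℕ) :
    ∀ v, S.dist root v = l →
      0 ≤ t v ∧ t v ≤ 2 * N * levelScale q 1 - 2 * N * levelScale q (l + 1) := by
  have hq := h.q_ge
  have hN := h.one_le_N
  induction l with
  | zero =>
    intro v hv
    have : v = root := (hS.dist_eq_zero_iff.1 hv).symm
    simp [this, h.root_eq]
  | succ l ih =>
    intro v hv
    obtain ⟨p, hp, hpl⟩ := hS.exists_adj_dist_of_dist_succ hv
    rw [h.child_eq p v hp (by omega), hv]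
    obtain ⟨h1, h2⟩ := ih p hpl
    have h3 := levelScale_pos (by linarith : 0 < q) (l + 1)
    have h4 := levelScale_pos (by linarith : 0 < q) (l + 2)
    have h5 := levelScale_succ_mul_le (by linarith : 1 ≤ q) (l + 1)
    have h6 : 2 * levelScale q (l + 2) ≤ levelScale q (l + 1) := by nlinarith
    have h7 : f v * levelScale q (l + 1) ≤ N * levelScale q (l + 1) := by
      gcongr; exact h.le v
    have h8 : 0 ≤ f v * levelScale q (l + 1) := by
      have := h.one_le v
      positivity
    have h9 : N * (2 * levelScale q (l + 2)) ≤ N * levelScale q (l + 1) := by gcongr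
    constructor <;> linarith

theorem t_mem (h : IsParameterization S root N q f t) (hS : S.Connected) (v : V) :
    0 ≤ t v ∧ t v ≤ 1 / 512 := by
  obtain ⟨h1, h2⟩ := h.t_bounds hS _ v rfl
  refine ⟨h1, h2.trans ?_⟩
  have hq := h.q_ge
  have hN := h.one_le_N
  have h3 := levelScale_pos (by linarith : 0 < q) (S.dist root v + 1)
  have h4 : 2 * N * levelScale q 1 ≤ 1 / 512 := by
    have : levelScale q 1 = 1 / q := by simp [levelScale]
    rw [this, mul_one_div, div_le_iff₀ (by linarith)]
    linarith [h.le_q]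
  have : 0 ≤ 2 * N * levelScale q (S.dist root v + 1) := by positivity
  linarith

/-- Siblings are separated by their multipliers. Otherwise the parents are separated by the previous
scale, and the two shifts differ by at most `N` times the new scale, which `q` makes negligible. -/
theorem t_sep (h : IsParameterization S root N q f t) (hS : S.Connected) (l : ℕ) :
    ∀ v w, v ≠ w → S.dist root v = l → S.dist root w = l → levelScale q l ≤ |t v - t w| := by
  have hq := h.q_ge
  have hN := h.one_le_N
  induction l with
  | zero =>
    intro v w hne hv hw
    exact absurd ((hS.dist_eq_zero_iff.1 hv).symm.trans (hS.dist_eq_zero_iff.1 hw)) hne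
  | succ l ih =>
    intro v w hne hv hw
    obtain ⟨p, hp, hpl⟩ := hS.exists_adj_dist_of_dist_succ hv
    obtain ⟨p', hp', hpl'⟩ := hS.exists_adj_dist_of_dist_succ hw
    have h3 := levelScale_pos (by linarith : 0 < q) (l + 1)
    rw [h.child_eq p v hp (by omega), h.child_eq p' w hp' (by omega), hv, hw]
    by_cases hpp : p = p'
    · subst hpp
      have e : t p + f v * levelScale q (l + 1) - (t p + f w * levelScale q (l + 1)) =
        (f v - f w) * levelScale q (l + 1) := by ring
      rw [e, abs_mul, abs_of_pos h3]
      have := h.sep v w hne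
      nlinarith
    · have h4 := ih p p' hpp hpl hpl'
      have e : t p + f v * levelScale q (l + 1) - (t p' + f w * levelScale q (l + 1)) =
        (t p - t p') - (f w - f v) * levelScale q (l + 1) := by ring
      have h5 : |(f w - f v) * levelScale q (l + 1)| ≤ N * levelScale q (l + 1) := by
        rw [abs_mul, abs_of_pos h3]
        gcongr
        rw [abs_le]
        constructor <;> linarith [h.one_le v, h.one_le w, h.le v, h.le w]
      have h6 := abs_sub_abs_le_abs_sub (t p - t p') ((f w - f v) * levelScale q (l + 1))
      have h7 := levelScale_succ_mul_le (by linarith : 1 ≤ q) l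
      have h8 : (N + 1) * levelScale q (l + 1) ≤ q * levelScale q (l + 1) := by
        gcongr; linarith [h.le_q]
      rw [e]
      linarith

/-- The bound `levelScale q l ^ 2 / 128` on tree edges is half radial, from the radii, and half
tangential, from the parameter shift. It is about the drop in squared norm, so these edges are
steep. -/
theorem isFinePlacement (h : IsParameterization S root N q f t) (hS : S.Connected) :
    IsFinePlacement S root (placement S root q t)
      (fun l => (1 + levelScale q l ^ 2 / 256) ^ 2 - 1) (levelScale q)
      (fun l => levelScale q l ^ 2 / 128) := by
  have hq := h.q_ge
  have hN := h.one_le_N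
  have pos := levelScale_pos (by linarith : 0 < q)
  have le1 := levelScale_le_one (by linarith : 1 ≤ q)
  have step : ∀ l, 2048 * levelScale q (l + 1) ≤ levelScale q l := fun l => by
    nlinarith [levelScale_succ_mul_le (by linarith : 1 ≤ q) l, pos (l + 1)]
  have sq1 : ∀ l, levelScale q l ^ 2 ≤ 1 := fun l => pow_le_one₀ (pos l).le (le1 l)
  have sqpos : ∀ l, 0 < levelScale q l ^ 2 := fun l => pow_pos (pos l) 2
  have sqstep : ∀ l, 8 * levelScale q (l + 1) ^ 2 ≤ levelScale q l ^ 2 := fun l => by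
    nlinarith [step l, pos l, pos (l + 1)]
  -- The true gap is close to `levelScale q l ^ 2 / 128`; the constant 200 leaves room above `len l
  -- / 2`, which has 256.
  have hgap : ∀ l, levelScale q l ^ 2 / 200 <
      (1 + levelScale q l ^ 2 / 256) ^ 2 - 1 - ((1 + levelScale q (l + 1) ^ 2 / 256) ^ 2 - 1) := by
    intro l
    nlinarith [sqstep l, sqpos l, sqpos (l + 1)]
  constructor
  · intro v
    rw [placement, norm_sq_circlePoint]; ring
  · intro l; nlinarith [sqpos l]
  · exact pos
  · intro l; linarith [hgap l, sqpos l]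
  · intro l; linarith [step l, pos (l + 1)]
  · intro l; linarith [sqstep l, sqpos (l + 1)]
  · intro l; positivity
  · intro l; nlinarith [pos l, le1 l]
  · intro l; nlinarith [sqpos l, sq1 l]
  · intro l; nlinarith [hgap l, sqpos l, sq1 l]
  · intro l; linarith [hgap l, sqpos l]
  · intro a b
    refine (norm_circlePoint_sub_le _ _ ?_ ?_ ?_).trans_lt ?_
    · positivity
    · linarith [sq1 (S.dist root b)]
    · linarith [sq1 (S.dist root a)]
    · have h1 : |1 + levelScale q (S.dist root b) ^ 2 / 256 -
          (1 + levelScale q (S.dist root a) ^ 2 / 256)| ≤ 1 / 256 := by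
        rw [abs_le]
        constructor <;> linarith [sq1 (S.dist root b), sq1 (S.dist root a),
          sqpos (S.dist root b), sqpos (S.dist root a)]
      have h2 : |t b - t a| ≤ 1 / 512 := by
        rw [abs_le]
        constructor <;> linarith [h.t_mem hS a, h.t_mem hS b]
      linarith
  · intro a b hne hab
    rw [placement, placement, hab]
    refine le_trans ?_ (le_norm_circlePoint_sub ?_ ?_ ?_)
    · exact h.t_sep hS _ b a hne.symm rfl hab
    · linarith [sqpos (S.dist root b)]
    · rw [abs_le]; constructor <;> linarith [h.t_mem hS b]
    · rw [abs_le]; constructor <;> linarith [h.t_mem hS a]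
  · intro a b hab hb
    refine (norm_circlePoint_sub_le _ _ ?_ ?_ ?_).trans ?_
    · positivity
    · linarith [sq1 (S.dist root b)]
    · linarith [sq1 (S.dist root a)]
    · rw [h.child_eq a b hab hb, hb]
      generalize S.dist root a = l
      have h1 : |1 + levelScale q (l + 1) ^ 2 / 256 - (1 + levelScale q l ^ 2 / 256)| ≤
          levelScale q l ^ 2 / 256 := by
        rw [abs_le]
        constructor <;> linarith [sqstep l, sqpos l, sqpos (l + 1)]
      have h2 : |t a + f b * levelScale q (l + 1) - t a| ≤ N * levelScale q (l + 1) := by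
        rw [add_sub_cancel_left, abs_of_nonneg]
        · have := pos (l + 1); gcongr; exact h.le b
        · have := pos (l + 1); have := h.one_le b; positivity
      -- This is why scales are squared: four times the parameter shift is at most `levelScale q l ^
      -- 2 / 256`.
      have h3 : 1024 * N * levelScale q (l + 1) ≤ levelScale q l ^ 2 := by
        rw [levelScale, mul_div_assoc', div_le_iff₀ (by linarith), mul_comm]
        gcongr
        linarith [h.le_q]
      linarith

end IsParameterization

open Classical in
/-- The parameters with given multipliers, computed level by level. -/
noncomputable def parameterAux (S : SimpleGraph V) (root : V) (q : ℝ) (f : V → ℝ) : ℕ → V → ℝ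
  | 0, _ => 0
  | l + 1, w => if h : ∃ u, S.Adj u w ∧ S.dist root u = l
      then parameterAux S root q f l h.choose + f w * levelScale q (l + 1) else 0

/-- A neighbour of `w` that is nearer to the root must be the penultimate vertex of the unique path
from the root to `w`: a shortest path to that neighbour is too short to contain `w`. -/
theorem SimpleGraph.IsTree.parent_unique {S : SimpleGraph V} (hS : S.IsTree) {root u u' w : V}
    (hu : S.Adj u w) (hu' : S.Adj u' w) (hd : S.dist root w = S.dist root u + 1)
    (hd' : S.dist root w = S.dist root u' + 1) : u = u' := by
  obtain ⟨p, hp, hpl⟩ := hS.connected.exists_path_of_dist root w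
  have key : ∀ v, S.Adj v w → S.dist root w = S.dist root v + 1 → v = p.penultimate := by
    intro v hv hdv
    obtain ⟨r, hr, hrl⟩ := hS.connected.exists_path_of_dist root v
    refine hS.isAcyclic.eq_penultimate_of_adj_end hp hv.symm
      (hS.isAcyclic.mem_support_of_ne_mem_support_of_adj_of_isPath hp hr hv.symm fun hw => ?_)
    classical
    have h1 := S.dist_le (r.takeUntil w hw)
    have h2 := r.length_takeUntil_le_length hw
    omega
  rw [key u hu hd, key u' hu' hd']

theorem exists_isParameterization [Finite V] {S : SimpleGraph V} (hS : S.IsTree) (root : V) :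
    ∃ (N q : ℝ) (f t : V → ℝ), IsParameterization S root N q f t := by
  obtain ⟨n, ⟨e⟩⟩ := Finite.exists_equiv_fin V
  refine ⟨n, 1024 * (n + 1), fun v => (e v : ℕ) + 1,
    fun v => parameterAux S root (1024 * (n + 1)) (fun v => (e v : ℕ) + 1) (S.dist root v) v,
    ⟨fun v => ?_, fun v => ?_, fun v w hne => ?_, le_rfl, ?_, fun u w huw hw => ?_⟩⟩
  · simp
  · exact_mod_cast (e v).isLt
  · have h1 : ((e v : ℕ) : ℤ) ≠ (e w : ℕ) := by
      intro h
      exact hne (e.injective (Fin.ext (by exact_mod_cast h)))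
    have h2 : 1 ≤ |((e v : ℕ) : ℤ) - (e w : ℕ)| := Int.one_le_abs (sub_ne_zero.2 h1)
    rw [add_sub_add_right_eq_sub]
    exact_mod_cast h2
  · simp [parameterAux]
  · rw [hw, parameterAux]
    have hex : ∃ u', S.Adj u' w ∧ S.dist root u' = S.dist root u := ⟨u, huw, rfl⟩
    have he : hex.choose = u :=
      hS.parent_unique hex.choose_spec.1 huw (by rw [hw, hex.choose_spec.2]) hw
    rw [dif_pos hex, he]

theorem exists_compatible_drawing [Finite V] {G S : SimpleGraph V} {root : V}
    (h : IsBFSTree G S root) :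
    ∃ Γ : V → Plane, IsCompatibleDrawing G S Γ ∧ LevelsOnNestedCircles S root Γ := by
  obtain ⟨N, q, f, t, hp⟩ := exists_isParameterization h.isTree root
  have := hp.isFinePlacement h.isTree.connected
  exact ⟨_, this.isCompatibleDrawing h, this.levelsOnNestedCircles⟩

end CirclePlacement

/-! ### Trees given by parent functions, and the existence of BFS-trees. -/

section ParentGraph

variable {V : Type u}

/-- The graph that joins every vertex other than the root to its parent. -/
def parentGraph (root : V) (parent : V → V) : SimpleGraph V :=
  SimpleGraph.fromRel fun v p => v ≠ root ∧ p = parent v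

variable {root : V} {parent : V → V} {lev : V → ℕ}

theorem parentGraph_adj_iff {a b : V} (hlev : ∀ v, v ≠ root → lev (parent v) + 1 = lev v) :
    (parentGraph root parent).Adj a b ↔
      (a ≠ root ∧ b = parent a) ∨ (b ≠ root ∧ a = parent b) := by
  rw [parentGraph, SimpleGraph.fromRel_adj, and_iff_right_iff_imp]
  rintro (⟨h1, h2⟩ | ⟨h1, h2⟩) rfl
  all_goals
    have := hlev a h1
    rw [← h2] at this
    omega

theorem parentGraph_reachable (hlev : ∀ v, v ≠ root → lev (parent v) + 1 = lev v) (v : V) :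
    ∃ p : (parentGraph root parent).Walk v root, p.length ≤ lev v := by
  induction hl : lev v generalizing v with
  | zero =>
    by_cases h : v = root
    · subst h; exact ⟨.nil, by simp⟩
    · have := hlev v h; omega
  | succ l ih =>
    by_cases h : v = root
    · subst h; exact ⟨.nil, by simp⟩
    · obtain ⟨p, hp⟩ := ih (parent v) (by have := hlev v h; omega)
      exact ⟨.cons ((parentGraph_adj_iff hlev).2 (.inl ⟨h, rfl⟩)) p, by simpa using hp⟩

theorem parentGraph_connected (hlev : ∀ v, v ≠ root → lev (parent v) + 1 = lev v) :
    (parentGraph root parent).Connected := by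
  have : Nonempty V := ⟨root⟩
  refine ⟨fun a b => ?_⟩
  obtain ⟨p, -⟩ := parentGraph_reachable hlev a
  obtain ⟨r, -⟩ := parentGraph_reachable hlev b
  exact p.reachable.trans r.reachable.symm

/-- Following parents gives a walk of length at most the level, and the level changes by exactly one
along every edge, so no walk is shorter. -/
theorem parentGraph_dist (hroot : lev root = 0)
    (hlev : ∀ v, v ≠ root → lev (parent v) + 1 = lev v) (v : V) :
    (parentGraph root parent).dist root v = lev v := by
  obtain ⟨p, hp⟩ := parentGraph_reachable hlev v
  have key : ∀ (a b : V) (r : (parentGraph root parent).Walk a b), lev a ≤ lev b + r.length := by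
    intro a b r
    induction r with
    | nil => simp
    | cons h r ih =>
      rw [SimpleGraph.Walk.length_cons]
      rcases (parentGraph_adj_iff hlev).1 h with ⟨h1, h2⟩ | ⟨h1, h2⟩
      all_goals
        have := hlev _ h1
        rw [← h2] at this
        omega
  obtain ⟨r, hr⟩ := (parentGraph_connected hlev).exists_walk_length_eq_dist v root
  have h1 := key v root r
  have h2 := (parentGraph root parent).dist_le p
  rw [SimpleGraph.dist_comm]
  omega

/-- Connectedness and a count: each non-root vertex contributes at most one edge. -/
theorem parentGraph_isTree [Finite V] (hlev : ∀ v, v ≠ root → lev (parent v) + 1 = lev v) :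
    (parentGraph root parent).IsTree := by
  have hc := parentGraph_connected hlev
  refine SimpleGraph.isTree_iff_connected_and_card.2 ⟨hc, le_antisymm ?_ ?_⟩
  · have hsub : (parentGraph root parent).edgeSet ⊆
        (fun v => s(v, parent v)) '' ({root}ᶜ : Set V) := by
      intro e
      induction e with
      | _ a b =>
        rw [SimpleGraph.mem_edgeSet, parentGraph_adj_iff hlev]
        rintro (⟨h1, rfl⟩ | ⟨h1, rfl⟩)
        · exact ⟨a, h1, rfl⟩
        · exact ⟨b, h1, Sym2.eq_swap⟩
    have h1 : (parentGraph root parent).edgeSet.ncard ≤ ({root}ᶜ : Set V).ncard :=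
      (Set.ncard_le_ncard hsub (Set.toFinite _)).trans (Set.ncard_image_le (Set.toFinite _))
    have h2 := Set.ncard_add_ncard_compl ({root} : Set V)
    rw [Set.ncard_singleton] at h2
    rw [Nat.card_coe_set_eq]
    omega
  · exact hc.card_vert_le_card_edgeSet_add_one

/-- Parents are chosen one step closer to the root in `G`, so tree levels are distances in `G`,
which differ by at most one along every edge. -/
theorem SimpleGraph.Connected.exists_isBFSTree [Finite V] {G : SimpleGraph V} (hG : G.Connected)
    (root : V) : ∃ S : SimpleGraph V, IsBFSTree G S root := by
  have hex : ∀ v, v ≠ root → ∃ p, G.Adj p v ∧ G.dist root p + 1 = G.dist root v := by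
    intro v hv
    have h1 := hG.pos_dist_of_ne hv.symm
    obtain ⟨p, hp, hpl⟩ := hG.exists_adj_dist_of_dist_succ
      (root := root) (v := v) (k := G.dist root v - 1) (by omega)
    exact ⟨p, hp, by omega⟩
  choose! parent hadj hpar using hex
  have hd := parentGraph_dist (lev := G.dist root) (by simp) hpar
  refine ⟨parentGraph root parent, ⟨?_, parentGraph_isTree hpar, ?_⟩⟩
  · intro a b hab
    rcases (parentGraph_adj_iff hpar).1 hab with ⟨h1, rfl⟩ | ⟨h1, rfl⟩
    · exact (hadj a h1).symm
    · exact hadj b h1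
  · intro a b hab _
    rw [hd, hd]
    rcases hab.diff_dist_adj (u := root) with h | h | h <;> omega

end ParentGraph

/-! ### Execution with step bounds, and the drawing program. -/

section RealRAMSemantics

namespace RealRAM

/-- The configuration after `k` steps from the configuration `c`, if there is one. -/
noncomputable def runFrom (P : Program) (x : ℕ → ℕ) : ℕ → Config → Option Config
  | 0, c => some c
  | k + 1, c => (step P x c).bind (runFrom P x k)

/-- `run` adds steps at the end and `runFrom` at the beginning; this reconciles the two. -/
theorem run_add (P : Program) (x : ℕ → ℕ) (k : ℕ) :
    ∀ t, run P x (t + k) = (run P x t).bind (runFrom P x k) := by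
  induction k with
  | zero => intro t; cases run P x t <;> simp [runFrom]
  | succ k ih =>
    intro t
    rw [show t + (k + 1) = (t + 1) + k by ring, ih, run, Option.bind_assoc]
    rfl

theorem run_eq_runFrom (P : Program) (x : ℕ → ℕ) (k : ℕ) :
    run P x k = runFrom P x k Config.init := by
  simpa [run] using run_add P x k 0

theorem runFrom_add (P : Program) (x : ℕ → ℕ) (l k : ℕ) (c : Config) :
    runFrom P x (k + l) c = (runFrom P x k c).bind (runFrom P x l) := by
  induction k generalizing c with
  | zero => simp [runFrom]
  | succ k ih =>
    rw [show k + 1 + l = (k + l) + 1 by ring, runFrom, runFrom, Option.bind_assoc]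
    congr 1
    funext c'
    exact ih c'

/-- Within `T` steps the program reaches a configuration that satisfies `Q`. -/
def Within (P : Program) (x : ℕ → ℕ) (T : ℕ) (c : Config) (Q : Config → Prop) : Prop :=
  ∃ k ≤ T, ∃ c', runFrom P x k c = some c' ∧ Q c'

namespace Within

variable {P : Program} {x : ℕ → ℕ} {T T' : ℕ} {c c' : Config} {Q Q' : Config → Prop}

theorem done (h : Q c) : Within P x T c Q := ⟨0, Nat.zero_le _, c, rfl, h⟩

theorem mono (h : Within P x T c Q) (hT : T ≤ T') : Within P x T' c Q := by
  obtain ⟨k, hk, r⟩ := h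
  exact ⟨k, hk.trans hT, r⟩

theorem trans (h : Within P x T c Q) (h' : ∀ c', Q c' → Within P x T' c' Q') :
    Within P x (T + T') c Q' := by
  obtain ⟨k, hk, c', hr, hQ⟩ := h
  obtain ⟨l, hl, c'', hr', hQ'⟩ := h' c' hQ
  exact ⟨k + l, by omega, c'', by rw [runFrom_add, hr]; exact hr', hQ'⟩

theorem of_step (h : step P x c = some c') (h' : Within P x T c' Q) : Within P x (T + 1) c Q := by
  obtain ⟨k, hk, c'', hr, hQ⟩ := h'
  exact ⟨k + 1, by omega, c'', by rw [runFrom, h]; exact hr, hQ⟩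

variable {pc d a b l : ℕ} {z : ℤ} {I : ℕ → ℕ} {R o : ℕ → ℝ}

theorem iconst {k : ℕ} (hP : P[pc]? = some (.iconst d k))
    (h : Within P x T ⟨pc + 1, Function.update I d k, R, o⟩ Q) :
    Within P x (T + 1) ⟨pc, I, R, o⟩ Q := of_step (by simp [step, hP, exec]) h

theorem iadd (hP : P[pc]? = some (.iadd d a b))
    (h : Within P x T ⟨pc + 1, Function.update I d (I a + I b), R, o⟩ Q) :
    Within P x (T + 1) ⟨pc, I, R, o⟩ Q := of_step (by simp [step, hP, exec]) h

theorem iload (hP : P[pc]? = some (.iload d a))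
    (h : Within P x T ⟨pc + 1, Function.update I d (I (I a)), R, o⟩ Q) :
    Within P x (T + 1) ⟨pc, I, R, o⟩ Q := of_step (by simp [step, hP, exec]) h

theorem istore (hP : P[pc]? = some (.istore a b))
    (h : Within P x T ⟨pc + 1, Function.update I (I a) (I b), R, o⟩ Q) :
    Within P x (T + 1) ⟨pc, I, R, o⟩ Q := of_step (by simp [step, hP, exec]) h

theorem input (hP : P[pc]? = some (.input d a))
    (h : Within P x T ⟨pc + 1, Function.update I d (x (I a)), R, o⟩ Q) :
    Within P x (T + 1) ⟨pc, I, R, o⟩ Q := of_step (by simp [step, hP, exec]) h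

theorem rconst (hP : P[pc]? = some (.rconst d z))
    (h : Within P x T ⟨pc + 1, I, Function.update R d (z : ℝ), o⟩ Q) :
    Within P x (T + 1) ⟨pc, I, R, o⟩ Q := of_step (by simp [step, hP, exec]) h

theorem cast (hP : P[pc]? = some (.cast d a))
    (h : Within P x T ⟨pc + 1, I, Function.update R d (I a : ℝ), o⟩ Q) :
    Within P x (T + 1) ⟨pc, I, R, o⟩ Q := of_step (by simp [step, hP, exec]) h

theorem radd (hP : P[pc]? = some (.radd d a b))
    (h : Within P x T ⟨pc + 1, I, Function.update R d (R a + R b), o⟩ Q) :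
    Within P x (T + 1) ⟨pc, I, R, o⟩ Q := of_step (by simp [step, hP, exec]) h

theorem rsub (hP : P[pc]? = some (.rsub d a b))
    (h : Within P x T ⟨pc + 1, I, Function.update R d (R a - R b), o⟩ Q) :
    Within P x (T + 1) ⟨pc, I, R, o⟩ Q := of_step (by simp [step, hP, exec]) h

theorem rmul (hP : P[pc]? = some (.rmul d a b))
    (h : Within P x T ⟨pc + 1, I, Function.update R d (R a * R b), o⟩ Q) :
    Within P x (T + 1) ⟨pc, I, R, o⟩ Q := of_step (by simp [step, hP, exec]) h

theorem rdiv (hP : P[pc]? = some (.rdiv d a b)) (h0 : R b ≠ 0)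
    (h : Within P x T ⟨pc + 1, I, Function.update R d (R a / R b), o⟩ Q) :
    Within P x (T + 1) ⟨pc, I, R, o⟩ Q := of_step (by simp [step, hP, exec, h0]) h

theorem rload (hP : P[pc]? = some (.rload d a))
    (h : Within P x T ⟨pc + 1, I, Function.update R d (R (I a)), o⟩ Q) :
    Within P x (T + 1) ⟨pc, I, R, o⟩ Q := of_step (by simp [step, hP, exec]) h

theorem rstore (hP : P[pc]? = some (.rstore a b))
    (h : Within P x T ⟨pc + 1, I, Function.update R (I a) (R b), o⟩ Q) :
    Within P x (T + 1) ⟨pc, I, R, o⟩ Q := of_step (by simp [step, hP, exec]) h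

theorem output (hP : P[pc]? = some (.output a b))
    (h : Within P x T ⟨pc + 1, I, R, Function.update o (I a) (R b)⟩ Q) :
    Within P x (T + 1) ⟨pc, I, R, o⟩ Q := of_step (by simp [step, hP, exec]) h

theorem ijump_taken (hP : P[pc]? = some (.ijump a b l)) (hc : I a ≤ I b)
    (h : Within P x T ⟨l, I, R, o⟩ Q) :
    Within P x (T + 1) ⟨pc, I, R, o⟩ Q := of_step (by simp [step, hP, exec, hc]) h

theorem ijump_not_taken (hP : P[pc]? = some (.ijump a b l)) (hc : ¬ I a ≤ I b)
    (h : Within P x T ⟨pc + 1, I, R, o⟩ Q) :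
    Within P x (T + 1) ⟨pc, I, R, o⟩ Q := of_step (by simp [step, hP, exec, hc]) h

theorem exists_haltsWith (h : Within P x T Config.init
    fun c => P[c.pc]? = some .halt ∧ Q c) :
    ∃ t ≤ T, ∃ c, HaltsWith P x t c.out ∧ Q c := by
  obtain ⟨k, hk, c, hr, hh, hQ⟩ := h
  exact ⟨k, hk, c, ⟨c, by rw [run_eq_runFrom, hr], hh, rfl⟩, hQ⟩

/-- Computing the address `16 * v + 16` of the record of a vertex `v`. -/
theorem address (hd : d ≠ 3) (h3 : I 3 = 16) (h1 : P[pc]? = some (.iadd d d d))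
    (h2 : P[pc + 1]? = some (.iadd d d d)) (h4 : P[pc + 2]? = some (.iadd d d d))
    (h5 : P[pc + 3]? = some (.iadd d d d)) (h6 : P[pc + 4]? = some (.iadd d d 3))
    (h : Within P x T ⟨pc + 5, Function.update I d (16 * I d + 16), R, o⟩ Q) :
    Within P x (T + 5) ⟨pc, I, R, o⟩ Q := by
  refine .iadd h1 <| .iadd h2 <| .iadd h4 <| .iadd h5 <| .iadd h6 ?_
  simp only [Function.update_self, Function.update_idem, Function.update_of_ne hd.symm, h3]
  convert h using 3
  ring

end Within

end RealRAM

/-- The drawing program. Its memory holds records of `16` cells, for vertices and for edges, the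
record of vertex `v` at address `16 * v + 16`. Instructions `0` to `38` build adjacency lists of the
tree, instructions `39` to `84` traverse the tree in breadth-first order and compute the parameter
and the scale of every vertex, and the rest computes the coordinates. -/
def drawProgram : RealRAM.Program :=
  [ .iconst 1 1, .iconst 2 2, .iconst 3 16, .input 4 1, .iconst 6 3, .iconst 7 24,
    -- loop over the edges, from instruction 6
    .ijump 4 5 39, .input 8 6, .iadd 6 6 1, .input 9 6, .iadd 6 6 1, .input 10 6, .iadd 6 6 1,
    .iadd 5 5 1, .ijump 10 0 6,
    .iadd 8 8 8, .iadd 8 8 8, .iadd 8 8 8, .iadd 8 8 8, .iadd 8 8 3,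
    .iadd 9 9 9, .iadd 9 9 9, .iadd 9 9 9, .iadd 9 9 9, .iadd 9 9 3,
    .iload 11 8, .istore 7 11, .istore 8 7, .iadd 7 7 1, .istore 7 9, .iadd 7 7 1,
    .iload 11 9, .istore 7 11, .istore 9 7, .iadd 7 7 1, .istore 7 8,
    .iconst 11 13, .iadd 7 7 11, .ijump 0 0 6,
    -- the queue holds the root, from instruction 39
    .input 4 0, .input 8 2,
    .iadd 8 8 8, .iadd 8 8 8, .iadd 8 8 8, .iadd 8 8 8, .iadd 8 8 3,
    .iadd 9 8 1, .istore 9 1, .iconst 5 18, .iconst 6 34, .istore 5 8,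
    .cast 2 4, .rconst 3 16384, .rmul 2 2 3, .rconst 3 1024, .radd 2 2 3, .rconst 3 1,
    .rstore 9 3, .iconst 7 0,
    -- next neighbour of the current vertex, from instruction 59
    .ijump 7 0 75, .iadd 8 7 1, .iload 8 8, .iload 7 7, .iadd 9 8 1, .iload 10 9, .ijump 1 10 59,
    .istore 9 1, .istore 6 8, .iadd 6 6 3, .cast 6 8, .rmul 6 6 5, .radd 6 6 4, .rstore 8 6,
    .rstore 9 5, .ijump 0 0 59,
    -- next vertex of the queue, from instruction 75
    .ijump 6 5 85, .iload 8 5, .iadd 5 5 3, .iload 7 8, .rload 4 8, .iadd 9 8 1, .rload 5 9,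
    .rmul 5 5 5, .rdiv 5 5 2, .ijump 0 0 59,
    -- loop over the vertices, from instruction 89
    .rconst 7 256, .iconst 5 0, .iconst 6 16, .iconst 7 0,
    .ijump 4 7 111, .rload 4 6, .iadd 8 6 1, .rload 5 8, .rmul 5 5 5, .rdiv 5 5 7, .radd 5 3 5,
    .rmul 6 4 4, .radd 8 3 6, .rsub 9 3 6, .radd 4 4 4, .rdiv 4 4 8, .rdiv 9 9 8, .rmul 4 5 4,
    .rmul 9 5 9, .output 5 4, .iadd 5 5 1, .output 5 9, .iadd 5 5 1, .iadd 6 6 3, .iadd 7 7 1,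
    .ijump 0 0 89, .halt ]

end RealRAMSemantics

/-! ### First phase of the program: adjacency lists of the tree. -/

section AdjacencyLists

open RealRAM

variable {n m : ℕ}

/-- In the memory `I`, a linked list with cells below `B` starts at `p`, and its items are the
records of the vertices in `L`. -/
def Chain (I : ℕ → ℕ) (B : ℕ) : ℕ → List (Fin n) → Prop
  | p, [] => p = 0
  | p, w :: L => (16 ≤ p ∧ p < B ∧ (p % 16 = 8 ∨ p % 16 = 10)) ∧
      I (p + 1) = 16 * w + 16 ∧ Chain I B (I p) L

/-- List cells occupy only residues 8 to 11 modulo 16, while list heads, visited flags and queue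
entries have residues 0, 1 and 2, so writing the latter preserves the lists. As `B` is even, both
halves of a cell lie below it. -/
theorem Chain.frame {I I' : ℕ → ℕ} {B B' : ℕ} (hB : B ≤ B') (hmod : B % 2 = 0)
    (hI : ∀ e, 16 ≤ e → e < B → 8 ≤ e % 16 → I' e = I e) {L : List (Fin n)} {p : ℕ}
    (h : Chain I B p L) : Chain I' B' p L := by
  induction L generalizing p with
  | nil => exact h
  | cons w L ih =>
    obtain ⟨⟨h1, h2, h3⟩, h4, h5⟩ := h
    refine ⟨⟨h1, by omega, h3⟩, ?_, ?_⟩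
    · rw [hI _ (by omega) (by omega) (by omega), h4]
    · rw [hI _ h1 h2 (by omega)]; exact ih h5

/-- Adding a cell with item `b` in front of the list of `a`. -/
theorem Chain.insert {I I' : ℕ → ℕ} {B : ℕ} {L : Fin n → List (Fin n)} {a b : Fin n}
    (h : ∀ v : Fin n, Chain I B (I (16 * v + 16)) (L v)) (hB : 16 ≤ B)
    (hmod : B % 16 = 8 ∨ B % 16 = 10) (h1 : I' B = I (16 * a + 16))
    (h2 : I' (B + 1) = 16 * b + 16) (h3 : I' (16 * a + 16) = B)
    (hI : ∀ e, 16 ≤ e → e ≠ B → e ≠ B + 1 → e ≠ 16 * a + 16 → I' e = I e) (v : Fin n) :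
    Chain I' (B + 2) (I' (16 * v + 16)) (Function.update L a (b :: L a) v) := by
  have hf : ∀ {L : List (Fin n)} {p : ℕ}, Chain I B p L → Chain I' (B + 2) p L := fun h =>
    h.frame (by omega) (by omega)
      fun e he1 he2 he3 => hI e he1 (by omega) (by omega) (by omega)
  by_cases hv : v = a
  · subst hv
    rw [Function.update_self, h3]
    refine ⟨⟨hB, by omega, hmod⟩, h2, ?_⟩
    rw [h1]
    exact hf (h v)
  · rw [Function.update_of_ne hv]
    have hv' : (v : ℕ) ≠ a := fun e => hv (Fin.ext e)
    rw [hI _ (by omega) (by omega) (by omega) (by omega)]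
    exact hf (h v)

theorem sum_length_update_cons (L : Fin n → List (Fin n)) (a b : Fin n) :
    ∑ v, (Function.update L a (b :: L a) v).length = ∑ v, (L v).length + 1 := by
  have : ∀ v, (Function.update L a (b :: L a) v).length = (L v).length + if v = a then 1 else 0 := by
    intro v
    by_cases h : v = a
    · subst h; simp
    · simp [h]
  simp [this, Finset.sum_add_distrib]

theorem mem_update_cons {L : Fin n → List (Fin n)} {a b v w : Fin n} :
    w ∈ Function.update L a (b :: L a) v ↔ w ∈ L v ∨ (a, b) = (v, w) := by
  by_cases h : v = a
  · subst h; simp [or_comm, eq_comm]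
  · simp [h, Ne.symm h]

theorem encodeInstance_fst {ends : Fin m → Fin n × Fin n} {mark : Fin m → Bool} {root : Fin n}
    {j : ℕ} (hj : j < m) : encodeInstance ends mark root (3 * j + 3) = (ends ⟨j, hj⟩).1 := by
  simp [encodeInstance, hj]

theorem encodeInstance_snd {ends : Fin m → Fin n × Fin n} {mark : Fin m → Bool} {root : Fin n}
    {j : ℕ} (hj : j < m) : encodeInstance ends mark root (3 * j + 4) = (ends ⟨j, hj⟩).2 := by
  have h1 : (3 * j + 1) / 3 = j := by omega
  have h2 : (3 * j + 1) % 3 = 1 := by omega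
  simp [encodeInstance, h1, h2, hj]

theorem encodeInstance_mark {ends : Fin m → Fin n × Fin n} {mark : Fin m → Bool} {root : Fin n}
    {j : ℕ} (hj : j < m) :
    encodeInstance ends mark root (3 * j + 5) = (mark ⟨j, hj⟩).toNat := by
  have h1 : (3 * j + 2) / 3 = j := by omega
  have h2 : (3 * j + 2) % 3 = 2 := by omega
  simp [encodeInstance, h1, h2, hj]

/-- The memory after the first `j` edges have been read. -/
structure AdjacencyInv (ends : Fin m → Fin n × Fin n) (mark : Fin m → Bool) (j : ℕ)
    (I : ℕ → ℕ) : Prop where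
  zero : I 0 = 0
  one : I 1 = 1
  two : I 2 = 2
  three : I 3 = 16
  four : I 4 = m
  five : I 5 = j
  six : I 6 = 3 * j + 3
  free : 16 ≤ I 7
  free_mod : I 7 % 16 = 8
  flag : ∀ v : Fin n, I (16 * v + 17) = 0
  lists : ∃ L : Fin n → List (Fin n), (∀ v : Fin n, Chain I (I 7) (I (16 * v + 16)) (L v)) ∧
    ∑ v, (L v).length ≤ 2 * j ∧
    ∀ v w, w ∈ L v ↔ ∃ i : Fin m, i < j ∧ mark i = true ∧ (ends i = (v, w) ∨ ends i = (w, v))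

variable {ends : Fin m → Fin n × Fin n} {mark : Fin m → Bool} {root : Fin n}

/-- Linking a new cell, at the address in `I[7]`, in front of the list of the record at the address
in `I[a]`, with the address in `I[b]` as its item. -/
theorem within_link {P : Program} {x : ℕ → ℕ} {T pc a b : ℕ} {I : ℕ → ℕ} {R o : ℕ → ℝ}
    {Q : Config → Prop} (h1 : I 1 = 1) (ha' : a ≠ 11) (hb : b ≠ 7) (hb' : b ≠ 11)
    (ha16 : a < 16) (hb16 : b < 16) (h7 : 16 ≤ I 7) (hIa : 16 ≤ I a) (hne : I a ≠ I 7)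
    (hne' : I a ≠ I 7 + 1)
    (p0 : P[pc]? = some (.iload 11 a)) (p1 : P[pc + 1]? = some (.istore 7 11))
    (p2 : P[pc + 1 + 1]? = some (.istore a 7)) (p3 : P[pc + 1 + 1 + 1]? = some (.iadd 7 7 1))
    (p4 : P[pc + 1 + 1 + 1 + 1]? = some (.istore 7 b))
    (h : ∀ I' : ℕ → ℕ, I' 7 = I 7 + 1 → I' (I 7) = I (I a) → I' (I 7 + 1) = I b → I' (I a) = I 7 →
      (∀ e, e ≠ 7 → e ≠ 11 → e ≠ I 7 → e ≠ I 7 + 1 → e ≠ I a → I' e = I e) →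
      Within P x T ⟨pc + 1 + 1 + 1 + 1 + 1, I', R, o⟩ Q) :
    Within P x (T + 5) ⟨pc, I, R, o⟩ Q := by
  refine .iload p0 <| .istore p1 <| .istore p2 <| .iadd p3 <| .istore p4 ?_
  simp (disch := omega) only [Function.update_self, Function.update_of_ne, h1]
  apply h
  any_goals simp (disch := omega) only [Function.update_self, Function.update_of_ne]
  intro e _ _ _ _ _
  simp (disch := omega) only [Function.update_of_ne]

theorem within_adjacency_init :
    Within drawProgram (encodeInstance ends mark root) 6 Config.init
      fun c => c.pc = 6 ∧ c.R = (fun _ => 0) ∧ AdjacencyInv ends mark 0 c.I := by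
  refine .iconst rfl <| .iconst rfl <| .iconst rfl <| .input rfl <| .iconst rfl <| .iconst rfl ?_
  refine .done ⟨rfl, rfl, ?_⟩
  simp only
  constructor <;> try simp [encodeInstance]
  · refine ⟨fun _ => [], ?_, ?_, ?_⟩ <;> simp [Chain]

theorem within_adjacency_step {j : ℕ} (hj : j < m) (hne : ∀ i, (ends i).1 ≠ (ends i).2)
    {I : ℕ → ℕ} {R o : ℕ → ℝ} (h : AdjacencyInv ends mark j I) :
    Within drawProgram (encodeInstance ends mark root) 33 ⟨6, I, R, o⟩
      fun c => c.pc = 6 ∧ c.R = R ∧ AdjacencyInv ends mark (j + 1) c.I := by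
  obtain ⟨L, hL, hsum, hmem⟩ := h.lists
  have h0 := h.zero
  have h1 := h.one
  have h3 := h.three
  have h6 := h.six
  have h7 := h.free
  have h7' := h.free_mod
  refine .ijump_not_taken rfl (by rw [h.four, h.five]; omega) ?_
  refine .input rfl <| .iadd rfl <| .input rfl <| .iadd rfl <| .input rfl <| .iadd rfl <|
    .iadd rfl ?_
  simp (disch := omega) only [Function.update_self, Function.update_of_ne, h1, h6, add_assoc,
    Nat.reduceAdd, encodeInstance_fst hj, encodeInstance_snd hj, encodeInstance_mark hj, h.five]
  have hmem' : ∀ v w : Fin n, (∃ i : Fin m, i < j + 1 ∧ mark i = true ∧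
      (ends i = (v, w) ∨ ends i = (w, v))) ↔ w ∈ L v ∨
      (mark ⟨j, hj⟩ = true ∧ (ends ⟨j, hj⟩ = (v, w) ∨ ends ⟨j, hj⟩ = (w, v))) := by
    intro v w
    rw [hmem]
    constructor
    · rintro ⟨i, hi, hr⟩
      rcases Nat.lt_succ_iff_lt_or_eq.1 hi with hi | hi
      · exact .inl ⟨i, hi, hr⟩
      · obtain rfl : i = ⟨j, hj⟩ := Fin.ext hi
        exact .inr hr
    · rintro (⟨i, hi, hr⟩ | hr)
      · exact ⟨i, by omega, hr⟩
      · exact ⟨_, Nat.lt_succ_self j, hr⟩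
  cases hm : mark ⟨j, hj⟩ with
  | false =>
    refine .ijump_taken rfl (by simp [h0]) ?_
    refine .done ⟨rfl, rfl, ?_⟩
    constructor
    any_goals simp (disch := omega) only [Function.update_self, Function.update_of_ne, h.zero,
      h.one, h.two, h.three, h.four, h7, h7', h.flag, implies_true]
    · ring
    · refine ⟨L, fun v => ?_, by omega, fun v w => ?_⟩
      · exact (hL v).frame le_rfl (by omega)
          fun e he _ _ => by simp (disch := omega) only [Function.update_of_ne]
      · rw [hmem', hm]; simp
  | true =>
    refine .ijump_not_taken rfl (by simp [h0]) ?_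
    refine .address (by decide) (by simp [h3]) rfl rfl rfl rfl rfl ?_
    refine .address (by decide) (by simp [h3]) rfl rfl rfl rfl rfl ?_
    have hab := hne ⟨j, hj⟩
    set a := (ends ⟨j, hj⟩).1 with ha
    set b := (ends ⟨j, hj⟩).2 with hb
    have hab' : (a : ℕ) ≠ b := fun e => hab (Fin.ext e)
    -- From here only the named registers and the agreement with `I` on the other relevant cells
    -- matter.
    generalize hJ : Function.update (Function.update _ 8 _) 9 _ = J
    have hJe : ∀ e, 11 ≤ e ∨ e = 7 ∨ e < 5 → J e = I e := by
      intro e he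
      subst hJ
      simp (disch := omega) only [Function.update_of_ne]
    have hJ5 : J 5 = j + 1 := by subst hJ; simp
    have hJ6 : J 6 = 3 * j + 6 := by subst hJ; simp
    have hJ8 : J 8 = 16 * a + 16 := by subst hJ; simp
    have hJ9 : J 9 = 16 * b + 16 := by subst hJ; simp
    clear hJ
    have hJ7 : J 7 = I 7 := hJe 7 (by omega)
    refine within_link (by rw [hJe _ (by omega), h1]) (by decide) (by decide) (by decide)
      (by decide) (by decide) (by omega) (by omega) (by omega) (by omega)
      rfl rfl rfl rfl rfl ?_
    rw [hJ7, hJ8, hJ9]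
    intro K hK7 hKB hKB' hKa hKe
    have hK1 : K 1 = 1 := by rw [hKe _ (by omega) (by omega) (by omega) (by omega) (by omega),
      hJe _ (by omega), h1]
    have hK8 : K 8 = 16 * a + 16 := by
      rw [hKe _ (by omega) (by omega) (by omega) (by omega) (by omega), hJ8]
    have hK9 : K 9 = 16 * b + 16 := by
      rw [hKe _ (by omega) (by omega) (by omega) (by omega) (by omega), hJ9]
    have hL1 := Chain.insert hL h7 (.inl h7') (a := a) (b := b) (I' := K)
      (by rw [hKB, hJe _ (by omega)]) hKB' hKa
      (fun e e1 e2 e3 e4 => by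
        rw [hKe e (by omega) (by omega) e2 e3 e4, hJe e (by omega)])
    refine .iadd rfl ?_
    refine within_link (by simp [hK1]) (by decide) (by decide) (by decide)
      (by decide) (by decide) (by simp; omega) (by simp [hK9])
      (by simp [hK9, hK1, hK7]; omega) (by simp [hK9, hK1, hK7]; omega)
      rfl rfl rfl rfl rfl ?_
    simp (disch := omega) only [Function.update_self, Function.update_of_ne, hK1, hK7, hK8, hK9,
      add_assoc, Nat.reduceAdd]
    intro M hM7 hMB hMB' hMb hMe
    have hL2 := Chain.insert hL1 (by omega) (.inr (by omega)) (a := b) (b := a) (I' := M)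
      hMB hMB' hMb (fun e e1 e2 e3 e4 => by
        rw [hMe e (by omega) (by omega) e2 e3 e4, Function.update_of_ne (by omega)])
    have hMr : ∀ e, e ≠ 7 → e ≤ 9 → M e = J e := by
      intro e e1 e2
      rw [hMe e (by omega) (by omega) (by omega) (by omega) (by omega),
        Function.update_of_ne (by omega),
        hKe e (by omega) (by omega) (by omega) (by omega) (by omega)]
    -- The free pointer has advanced by 3 during the two links; adding 13 moves it to residue 8 of
    -- the next block.
    refine .iconst rfl <| .iadd rfl <| .ijump_taken rfl ?_ <| .done ⟨rfl, rfl, ?_⟩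
    · exact le_rfl
    simp (disch := omega) only [Function.update_self, Function.update_of_ne, hM7]
    constructor
    any_goals simp (disch := omega) only [Function.update_self, Function.update_of_ne, hMr, hJe,
      hJ5, hJ6, h.zero, h.one, h.two, h.three, h.four]
    · ring
    · omega
    · omega
    · intro v
      rw [hMe _ (by omega) (by omega) (by omega) (by omega) (by omega),
        Function.update_of_ne (by omega),
        hKe _ (by omega) (by omega) (by omega) (by omega) (by omega), hJe _ (by omega), h.flag]
    · refine ⟨Function.update (Function.update L a (b :: L a)) b
        (a :: Function.update L a (b :: L a) b), fun v => ?_, ?_, fun v w => ?_⟩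
      · exact (hL2 v).frame (by omega) (by omega)
          fun e he _ _ => by simp (disch := omega) only [Function.update_of_ne]
      · rw [sum_length_update_cons, sum_length_update_cons]; omega
      · rw [hmem', mem_update_cons, mem_update_cons, hm]
        have : ends ⟨j, hj⟩ = (a, b) := rfl
        rw [this]
        simp only [Prod.mk.injEq, true_and, or_assoc]
        tauto

theorem within_adjacency (hne : ∀ i, (ends i).1 ≠ (ends i).2) :
    Within drawProgram (encodeInstance ends mark root) (6 + (33 * m + 1)) Config.init
      fun c => c.pc = 39 ∧ c.R = (fun _ => 0) ∧ AdjacencyInv ends mark m c.I := by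
  refine within_adjacency_init.trans ?_
  rintro ⟨pc, I, R, o⟩ ⟨rfl, hR, hI⟩
  simp only at hR hI
  have key : ∀ r j : ℕ, j + r = m → ∀ I o, AdjacencyInv ends mark j I →
      Within drawProgram (encodeInstance ends mark root) (33 * r + 1) ⟨6, I, R, o⟩
      fun c => c.pc = 39 ∧ c.R = R ∧ AdjacencyInv ends mark m c.I := by
    intro r
    induction r with
    | zero =>
      intro j hj I o h
      obtain rfl : j = m := hj
      exact .ijump_taken rfl (by rw [h.four, h.five]) <| .done ⟨rfl, rfl, h⟩
    | succ r ih =>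
      intro j hj I o h
      refine ((within_adjacency_step (by omega) hne h).trans ?_).mono
        (show 33 + (33 * r + 1) ≤ _ by omega)
      rintro ⟨pc, I', R', o'⟩ ⟨rfl, hR', hI'⟩
      simp only at hR' hI'
      subst hR'
      exact ih (j + 1) (by omega) I' o' hI'
  subst hR
  exact key m 0 (by omega) I o hI

end AdjacencyLists

/-! ### Second phase: breadth-first traversal computing parameters and scales. -/

section BreadthFirstSearch

open RealRAM

variable {n m : ℕ}

/-- The real memory holds the parameters (in the cells `16 * v + 16`) and the scales (in the cells
`16 * v + 17`) of the visited vertices. -/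
structure PlacedInv (S : SimpleGraph (Fin n)) (root : Fin n) (q : ℝ) (R : ℕ → ℝ)
    (vis : Fin n → Prop) : Prop where
  root_eq : R (16 * root + 16) = 0
  scale : ∀ w : Fin n, vis w → R (16 * w + 17) = levelScale q (S.dist root w)
  parent : ∀ w : Fin n, vis w → w ≠ root → ∃ p : Fin n, vis p ∧ S.Adj p w ∧
    S.dist root w = S.dist root p + 1 ∧
    R (16 * w + 16) = R (16 * p + 16) + (16 * w + 16 : ℕ) * levelScale q (S.dist root w)

/-- The memory during the search: `D` is the set of vertices that have left the queue, `W` is the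
queue, and `cur` are the neighbours of the current vertex that have not been looked at. -/
structure SearchInv (S : SimpleGraph (Fin n)) (root : Fin n) (q : ℝ) (B : ℕ)
    (L : Fin n → List (Fin n)) (D : Finset (Fin n)) (W cur : List (Fin n)) (I : ℕ → ℕ)
    (R : ℕ → ℝ) : Prop where
  zero : I 0 = 0
  one : I 1 = 1
  three : I 3 = 16
  four : I 4 = n
  queue : ∃ a, I 5 = 16 * a + 18 ∧ I 6 = 16 * (a + W.length) + 18 ∧
    ∀ i (h : i < W.length), I (16 * (a + i) + 18) = 16 * (W[i] : ℕ) + 16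
  visited : ∀ v : Fin n, v ∈ D ∨ v ∈ W → I (16 * v + 17) = 1
  unvisited : ∀ v : Fin n, ¬ (v ∈ D ∨ v ∈ W) → I (16 * v + 17) = 0
  lists : ∀ v : Fin n, Chain I B (I (16 * v + 16)) (L v)
  cur_list : Chain I B (I 7) cur
  q_eq : R 2 = q
  one_eq : R 3 = 1
  nodup : W.Nodup
  disjoint : ∀ v ∈ W, v ∉ D
  root_mem : root ∈ D ∨ root ∈ W
  placed : PlacedInv S root q R fun v => v ∈ D ∨ v ∈ W
  cur_adj : cur ≠ [] → ∃ u : Fin n, u ∈ D ∧ R 4 = R (16 * u + 16) ∧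
    R 5 = levelScale q (S.dist root u + 1) ∧ ∀ w ∈ cur, S.Adj u w
  closed : ∀ v ∈ D, ∀ w ∈ L v, (w ∈ D ∨ w ∈ W) ∨ w ∈ cur

variable {S : SimpleGraph (Fin n)} {root : Fin n} {q : ℝ} {B : ℕ} {L : Fin n → List (Fin n)}
  {D : Finset (Fin n)} {W cur : List (Fin n)} {I : ℕ → ℕ} {R o : ℕ → ℝ} {x : ℕ → ℕ}

theorem PlacedInv.congr {R' : ℕ → ℝ} {vis vis' : Fin n → Prop} (h : PlacedInv S root q R vis)
    (hR : ∀ e, 16 ≤ e → R' e = R e) (hv : ∀ v, vis v ↔ vis' v) : PlacedInv S root q R' vis' := by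
  obtain rfl : vis = vis' := funext fun v => propext (hv v)
  refine ⟨?_, fun w hw => ?_, fun w hw hne => ?_⟩
  · rw [hR _ (by omega), h.root_eq]
  · rw [hR _ (by omega), h.scale w hw]
  · obtain ⟨p, h1, h2, h3, h4⟩ := h.parent w hw hne
    exact ⟨p, h1, h2, h3, by rw [hR _ (by omega), hR _ (by omega), h4]⟩

/-- An unvisited neighbour of a visited vertex is on the next level. -/
theorem PlacedInv.dist_eq {vis : Fin n → Prop} (h : PlacedInv S root q R vis) (hS : S.IsTree)
    (hroot : vis root) {u w : Fin n} (hu : vis u) (hw : ¬ vis w) (huw : S.Adj u w) :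
    S.dist root w = S.dist root u + 1 := by
  rcases hS.dist_eq_dist_add_one_of_adj root huw with hd | hd
  · exfalso
    have hne : u ≠ root := by
      rintro rfl
      simp at hd
    obtain ⟨p, h1, h2, h3, -⟩ := h.parent u hu hne
    exact hw (hS.parent_unique h2 huw.symm h3 hd ▸ h1)
  · exact hd

theorem PlacedInv.extend {R' : ℕ → ℝ} {vis vis' : Fin n → Prop} (h : PlacedInv S root q R vis)
    (hroot : vis root) {u w : Fin n} (hu : vis u) (hw : ¬ vis w) (huw : S.Adj u w)
    (hd : S.dist root w = S.dist root u + 1)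
    (h1 : R' (16 * w + 16) =
      R (16 * u + 16) + (16 * w + 16 : ℕ) * levelScale q (S.dist root w))
    (h2 : R' (16 * w + 17) = levelScale q (S.dist root w))
    (hR : ∀ e : ℕ, 16 ≤ e → e ≠ 16 * w + 16 → e ≠ 16 * w + 17 → R' e = R e)
    (hv : ∀ v, vis' v ↔ vis v ∨ v = w) : PlacedInv S root q R' vis' := by
  have key : ∀ v, vis v → R' (16 * v + 16) = R (16 * v + 16) ∧
      R' (16 * v + 17) = R (16 * v + 17) := by
    intro v hvis
    have : (v : ℕ) ≠ w := fun e => hw (Fin.ext e ▸ hvis)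
    exact ⟨hR _ (by omega) (by omega) (by omega), hR _ (by omega) (by omega) (by omega)⟩
  refine ⟨?_, fun v hvis => ?_, fun v hvis hne => ?_⟩
  · rw [(key root hroot).1, h.root_eq]
  · rcases (hv v).1 hvis with hvis | rfl
    · rw [(key v hvis).2, h.scale v hvis]
    · exact h2
  · rcases (hv v).1 hvis with hvis | rfl
    · obtain ⟨p, h3, h4, h5, h6⟩ := h.parent v hvis hne
      exact ⟨p, (hv p).2 (.inl h3), h4, h5, by rw [(key v hvis).1, (key p h3).1, h6]⟩
    · exact ⟨u, (hv u).2 (.inl hu), huw, hd, by rw [h1, (key u hu).1]⟩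

theorem within_skip_visited {w : Fin n} (h : SearchInv S root q B L D W (w :: cur) I R)
    (hw : w ∈ D ∨ w ∈ W) (hB : B % 2 = 0) :
    Within drawProgram x 7 ⟨59, I, R, o⟩
      fun c => c.pc = 59 ∧ SearchInv S root q B L D W cur c.I c.R := by
  obtain ⟨⟨h16, hlt, hmod⟩, hval, hch⟩ := h.cur_list
  have h1 := h.one
  have hf := h.visited w hw
  refine .ijump_not_taken rfl (by rw [h.zero]; omega) ?_
  refine .iadd rfl <| .iload rfl <| .iload rfl <| .iadd rfl <| .iload rfl ?_
  simp (disch := omega) only [Function.update_self, Function.update_of_ne, h1, hval, hf, add_assoc,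
    Nat.reduceAdd]
  refine .ijump_taken rfl ?_ <| .done ⟨rfl, ?_⟩
  · simp (disch := omega) only [Function.update_self, Function.update_of_ne, h1, le_refl]
  have hframe : ∀ {p : ℕ} {l : List (Fin n)}, Chain I B p l → Chain (Function.update
      (Function.update (Function.update (Function.update (Function.update I 8 (I 7 + 1)) 8
      (16 * w + 16)) 7 (I (I 7))) 9 (16 * w + 17)) 10 1) B p l := fun hc =>
    hc.frame le_rfl hB fun e he _ _ => by simp (disch := omega) only [Function.update_of_ne]
  constructor
  any_goals simp (disch := omega) only [Function.update_self, Function.update_of_ne, h.zero,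
      h1, h.three, h.four]
  · obtain ⟨a, h5, h6, hq⟩ := h.queue
    exact ⟨a, h5, h6, hq⟩
  · exact h.visited
  · exact h.unvisited
  · exact fun v => hframe (h.lists v)
  · exact hframe hch
  · exact h.q_eq
  · exact h.one_eq
  · exact h.nodup
  · exact h.disjoint
  · exact h.root_mem
  · exact h.placed
  · intro _
    obtain ⟨u, h2, h3, h4, h5⟩ := h.cur_adj (by simp)
    exact ⟨u, h2, h3, h4, fun v hv => h5 v (by simp [hv])⟩
  · intro v hv z hz
    rcases h.closed v hv z hz with h2 | h2
    · exact .inl h2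
    · rcases List.mem_cons.1 h2 with rfl | h2
      · exact .inl hw
      · exact .inr h2

theorem within_visit {w : Fin n} (hS : S.IsTree) (h : SearchInv S root q B L D W (w :: cur) I R)
    (hw : ¬ (w ∈ D ∨ w ∈ W)) (hB : B % 2 = 0) :
    Within drawProgram x 16 ⟨59, I, R, o⟩
      fun c => c.pc = 59 ∧ SearchInv S root q B L D (W ++ [w]) cur c.I c.R := by
  obtain ⟨⟨h16, hlt, hmod⟩, hval, hch⟩ := h.cur_list
  have h1 := h.one
  have hf := h.unvisited w hw
  obtain ⟨a, h5, h6, hq⟩ := h.queue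
  obtain ⟨u, hu, hR4, hR5, hadj⟩ := h.cur_adj (by simp)
  -- An unvisited neighbour is a child, so the shift with the scale in `R 5` is the right one.
  have hd := h.placed.dist_eq hS h.root_mem (.inl hu) hw (hadj w (by simp))
  refine .ijump_not_taken rfl (by rw [h.zero]; omega) ?_
  refine .iadd rfl <| .iload rfl <| .iload rfl <| .iadd rfl <| .iload rfl ?_
  simp (disch := omega) only [Function.update_self, Function.update_of_ne, h1, hval, hf, add_assoc,
    Nat.reduceAdd]
  refine .ijump_not_taken rfl ?_ ?_
  · simp (disch := omega) only [Function.update_self, Function.update_of_ne, h1]; omega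
  generalize hJ : Function.update (Function.update _ 9 _) 10 _ = J
  have hJe : ∀ e, 11 ≤ e ∨ e < 7 → J e = I e := by
    intro e he
    subst hJ
    simp (disch := omega) only [Function.update_of_ne]
  have hJ7 : J 7 = I (I 7) := by subst hJ; simp
  have hJ8 : J 8 = 16 * w + 16 := by subst hJ; simp
  have hJ9 : J 9 = 16 * w + 17 := by subst hJ; simp
  clear hJ
  have hJ1 : J 1 = 1 := by rw [hJe _ (by omega), h1]
  have hJ3 : J 3 = 16 := by rw [hJe _ (by omega), h.three]
  have hJ6 : J 6 = 16 * (a + W.length) + 18 := by rw [hJe _ (by omega), h6]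
  refine .istore rfl <| .istore rfl <| .iadd rfl <| .cast rfl <| .rmul rfl <| .radd rfl <|
    .rstore rfl <| .rstore rfl <| .ijump_taken rfl le_rfl <| .done ⟨rfl, ?_⟩
  simp (disch := omega) only [Function.update_self, Function.update_of_ne, hJ1, hJ3, hJ6, hJ8, hJ9,
    hR4, hR5]
  generalize hK : Function.update (Function.update (Function.update J _ _) _ _) 6 _ = K
  have hKe : ∀ e : ℕ, e ≠ 16 * w + 17 → e ≠ 16 * (a + W.length) + 18 → e ≠ 6 → K e = J e := by
    intro e e1 e2 e3
    subst hK
    simp (disch := omega) only [Function.update_of_ne]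
  have hKf : K (16 * w + 17) = 1 := by
    subst hK
    simp (disch := omega) only [Function.update_of_ne, Function.update_self]
  have hKq : K (16 * (a + W.length) + 18) = 16 * w + 16 := by
    subst hK
    simp (disch := omega) only [Function.update_of_ne, Function.update_self]
  have hK6 : K 6 = 16 * (a + W.length + 1) + 18 := by
    subst hK
    rw [Function.update_self]; ring
  clear hK
  have hframe : ∀ {p : ℕ} {l : List (Fin n)}, Chain I B p l → Chain K B p l := fun hc =>
    hc.frame le_rfl hB fun e he _ _ => by
      rw [hKe e (by omega) (by omega) (by omega), hJe e (by omega)]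
  have hmem : ∀ v, (v ∈ D ∨ v ∈ W ++ [w]) ↔ (v ∈ D ∨ v ∈ W) ∨ v = w := by
    intro v; simp [or_assoc]
  constructor
  any_goals simp (disch := omega) only [Function.update_of_ne, hKe, hJe, h.zero, h1, h.three,
    h.four]
  · refine ⟨a, h5, by simpa [add_assoc] using hK6, fun i hi => ?_⟩
    rw [List.length_append, List.length_singleton] at hi
    rcases Nat.lt_succ_iff_lt_or_eq.1 hi with hi | rfl
    · rw [hKe _ (by omega) (by omega) (by omega), hJe _ (by omega), hq i hi,
        List.getElem_append_left hi]
    · simpa using hKq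
  · intro v hv
    by_cases hvw : v = w
    · rw [hvw, hKf]
    · have : (v : ℕ) ≠ w := fun e => hvw (Fin.ext e)
      rw [hKe _ (by omega) (by omega) (by omega), hJe _ (by omega)]
      exact h.visited v (((hmem v).1 hv).resolve_right hvw)
  · intro v hv
    rw [hmem, not_or] at hv
    have : (v : ℕ) ≠ w := fun e => hv.2 (Fin.ext e)
    rw [hKe _ (by omega) (by omega) (by omega), hJe _ (by omega)]
    exact h.unvisited v hv.1
  · exact fun v => hframe (h.lists v)
  · rw [hJ7]; exact hframe hch
  · exact h.q_eq
  · exact h.one_eq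
  · rw [List.nodup_append]
    refine ⟨h.nodup, by simp, ?_⟩
    rintro v hv _ hv' rfl
    obtain rfl := List.mem_singleton.1 hv'
    exact hw (.inr hv)
  · intro v hv
    rcases List.mem_append.1 hv with hv | hv
    · exact h.disjoint v hv
    · obtain rfl := List.mem_singleton.1 hv
      exact fun hD => hw (.inl hD)
  · exact (hmem _).2 (.inl h.root_mem)
  · refine h.placed.extend h.root_mem (.inl hu) hw (hadj w (by simp)) hd ?_ ?_ ?_ hmem
    · simp (disch := omega) only [Function.update_of_ne, Function.update_self, hd]
      ring
    · simp (disch := omega) only [Function.update_self, hd]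
    · intro e e1 e2 e3
      simp (disch := omega) only [Function.update_of_ne]
  · intro _
    refine ⟨u, hu, ?_, hR5, fun v hv => hadj v (by simp [hv])⟩
    have : (u : ℕ) ≠ w := fun e => hw (.inl (Fin.ext e ▸ hu))
    simp (disch := omega) only [Function.update_of_ne, hR4]
  · intro v hv z hz
    rw [hmem]
    rcases h.closed v hv z hz with h2 | h2
    · exact .inl (.inl h2)
    · rcases List.mem_cons.1 h2 with rfl | h2
      · exact .inl (.inr rfl)
      · exact .inr h2

theorem within_dequeue {u : Fin n} (hL : ∀ v w, w ∈ L v ↔ S.Adj v w) (hq0 : q ≠ 0)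
    (h : SearchInv S root q B L D (u :: W) [] I R) (hB : B % 2 = 0) :
    Within drawProgram x 11 ⟨59, I, R, o⟩
      fun c => c.pc = 59 ∧ SearchInv S root q B L (insert u D) W (L u) c.I c.R := by
  have h0 := h.zero
  have h1 := h.one
  have h3 := h.three
  have h7 : I 7 = 0 := h.cur_list
  obtain ⟨a, h5, h6, hq⟩ := h.queue
  have hu := hq 0 (by simp)
  simp only [add_zero, List.getElem_cons_zero] at hu
  rw [List.length_cons] at h6
  have hsc := h.placed.scale u (by simp)
  refine .ijump_taken rfl (by omega) ?_
  refine .ijump_not_taken rfl (by omega) ?_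
  refine .iload rfl <| .iadd rfl <| .iload rfl <| .rload rfl <| .iadd rfl <| .rload rfl <|
    .rmul rfl <| .rdiv rfl ?_ <| .ijump_taken rfl le_rfl <| .done ⟨rfl, ?_⟩
  · simp (disch := omega) only [Function.update_of_ne, h.q_eq]; exact hq0
  simp (disch := omega) only [Function.update_self, Function.update_of_ne, h1, h3, h5, hu, h.q_eq,
    add_assoc, Nat.reduceAdd, hsc]
  have hframe : ∀ {p : ℕ} {l : List (Fin n)}, Chain I B p l → Chain (Function.update
      (Function.update (Function.update (Function.update I 8 (16 * u + 16)) 5 (16 * a + 34)) 7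
      (I (16 * u + 16))) 9 (16 * u + 17)) B p l := fun hc =>
    hc.frame le_rfl hB fun e he _ _ => by simp (disch := omega) only [Function.update_of_ne]
  have hmem : ∀ v, (v ∈ D ∨ v ∈ u :: W) ↔ (v ∈ insert u D ∨ v ∈ W) := by
    intro v
    simp only [List.mem_cons, Finset.mem_insert]
    tauto
  constructor
  any_goals simp (disch := omega) only [Function.update_self, Function.update_of_ne, h0,
      h1, h3, h.four]
  · refine ⟨a + 1, by ring, by rw [h6]; ring, fun i hi => ?_⟩
    rw [show a + 1 + i = a + (i + 1) by ring, hq (i + 1) (by simpa using hi)]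
    simp
  · exact fun v hv => h.visited v ((hmem v).2 hv)
  · exact fun v hv => h.unvisited v (fun hv' => hv ((hmem v).1 hv'))
  · exact fun v => hframe (h.lists v)
  · exact hframe (h.lists u)
  · exact h.q_eq
  · exact h.one_eq
  · exact (List.nodup_cons.1 h.nodup).2
  · intro v hv
    rw [Finset.mem_insert, not_or]
    exact ⟨fun e => (List.nodup_cons.1 h.nodup).1 (e ▸ hv), h.disjoint v (by simp [hv])⟩
  · exact (hmem _).1 h.root_mem
  · refine h.placed.congr (fun e he => ?_) hmem
    simp (disch := omega) only [Function.update_of_ne]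
  · intro _
    refine ⟨u, by simp, rfl, ?_, fun w hw => (hL u w).1 hw⟩
    -- The quotient just computed, the squared scale of `u` over `q`, is the scale of the children
    -- of `u`.
    rw [levelScale]; ring
  · intro v hv w hw
    rcases Finset.mem_insert.1 hv with rfl | hv
    · exact .inr hw
    · left
      rcases h.closed v hv w hw with h2 | h2
      · exact (hmem w).1 h2
      · simp at h2

/-- With nothing pending, `D` contains the root and is closed under tree neighbours. -/
theorem all_visited_of_closed (hS : S.Connected) (hL : ∀ v w, w ∈ L v ↔ S.Adj v w)
    (h : SearchInv S root q B L D [] [] I R) (v : Fin n) : v ∈ D := by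
  have hroot : root ∈ D := by simpa using h.root_mem
  have key : ∀ (a b : Fin n) (p : S.Walk a b), a ∈ D → b ∈ D := by
    intro a b p ha
    induction p with
    | nil => exact ha
    | cons hadj p ih => exact ih (by simpa using h.closed _ ha _ ((hL _ _).2 hadj))
  obtain ⟨p⟩ := hS.preconnected root v
  exact key _ _ p hroot

/-- The potential is the number of pending neighbours plus `1 + (L v).length` for each vertex not
yet dequeued. Every pass of the loop lowers it by exactly one, since dequeuing `u` trades `1 + (L
u).length` for `(L u).length` pending neighbours, and costs at most 16 steps. -/
theorem within_search (hS : S.IsTree) (hL : ∀ v w, w ∈ L v ↔ S.Adj v w) (hq0 : q ≠ 0)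
    (hB : B % 2 = 0) (φ : ℕ) :
    ∀ (D : Finset (Fin n)) (W cur : List (Fin n)) (I : ℕ → ℕ) (R o : ℕ → ℝ),
      SearchInv S root q B L D W cur I R →
      cur.length + ∑ v ∈ Dᶜ, (1 + (L v).length) ≤ φ →
      Within drawProgram x (16 * φ + 2) ⟨59, I, R, o⟩ fun c => c.pc = 85 ∧ c.I 0 = 0 ∧
        c.I 1 = 1 ∧ c.I 3 = 16 ∧ c.I 4 = n ∧ c.R 3 = 1 ∧
        PlacedInv S root q c.R fun _ => True := by
  have finish : ∀ (T : ℕ) (D : Finset (Fin n)) (I : ℕ → ℕ) (R o : ℕ → ℝ),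
      SearchInv S root q B L D [] [] I R →
      Within drawProgram x (T + 2) ⟨59, I, R, o⟩ fun c => c.pc = 85 ∧ c.I 0 = 0 ∧
        c.I 1 = 1 ∧ c.I 3 = 16 ∧ c.I 4 = n ∧ c.R 3 = 1 ∧
        PlacedInv S root q c.R fun _ => True := by
    intro T D I R o h
    have h7 : I 7 = 0 := h.cur_list
    obtain ⟨a, h5, h6, -⟩ := h.queue
    refine .ijump_taken rfl (by omega) <| .ijump_taken rfl (by rw [h5, h6]; simp) <|
      .done ⟨rfl, h.zero, h.one, h.three, h.four, h.one_eq, ?_⟩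
    exact h.placed.congr (fun _ _ => rfl)
      fun v => iff_of_true (.inl (all_visited_of_closed hS.connected hL h v)) trivial
  have split : ∀ {D : Finset (Fin n)} {u : Fin n}, u ∉ D →
      ∑ v ∈ Dᶜ, (1 + (L v).length) =
        (1 + (L u).length) + ∑ v ∈ (insert u D)ᶜ, (1 + (L v).length) := by
    intro D u hu
    rw [Finset.compl_insert, Finset.add_sum_erase _ (fun v => 1 + (L v).length) (by simpa using hu)]
  induction φ with
  | zero =>
    intro D W cur I R o h hφ
    obtain rfl : cur = [] := List.length_eq_zero_iff.1 (by omega)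
    cases W with
    | nil => exact finish _ D I R o h
    | cons u W =>
      rw [split (h.disjoint u (by simp))] at hφ
      omega
  | succ φ ih =>
    intro D W cur I R o h hφ
    cases cur with
    | nil =>
      cases W with
      | nil => exact finish _ D I R o h
      | cons u W =>
        rw [split (h.disjoint u (by simp)), List.length_nil] at hφ
        refine ((within_dequeue hL hq0 h hB).trans ?_).mono
          (show 11 + (16 * φ + 2) ≤ _ by omega)
        rintro ⟨pc, I', R', o'⟩ ⟨rfl, h'⟩
        exact ih _ _ _ _ _ _ h' (by omega)
    | cons w cur =>
      rw [List.length_cons] at hφ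
      by_cases hw : w ∈ D ∨ w ∈ W
      · refine ((within_skip_visited h hw hB).trans ?_).mono
          (show 7 + (16 * φ + 2) ≤ _ by omega)
        rintro ⟨pc, I', R', o'⟩ ⟨rfl, h'⟩
        exact ih _ _ _ _ _ _ h' (by omega)
      · refine ((within_visit hS h hw hB).trans ?_).mono
          (show 16 + (16 * φ + 2) ≤ _ by omega)
        rintro ⟨pc, I', R', o'⟩ ⟨rfl, h'⟩
        exact ih _ _ _ _ _ _ h' (by omega)

theorem within_search_init {ends : Fin m → Fin n × Fin n} {mark : Fin m → Bool}
    (h : AdjacencyInv ends mark m I) (hL : ∀ v : Fin n, Chain I (I 7) (I (16 * v + 16)) (L v))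
    (hq : q = 16384 * n + 1024) :
    Within drawProgram (encodeInstance ends mark root) 20 ⟨39, I, fun _ => 0, o⟩
      fun c => c.pc = 59 ∧ SearchInv S root q (I 7) L ∅ [root] [] c.I c.R := by
  have h1 := h.one
  have h3 := h.three
  have h7 := h.free_mod
  refine .input rfl <| .input rfl <| .address (by decide) (by simp [h3]) rfl rfl rfl rfl rfl ?_
  have e0 : encodeInstance ends mark root 0 = n := rfl
  have e2 : encodeInstance ends mark root 2 = root := rfl
  simp (disch := omega) only [Function.update_self, Function.update_of_ne, h.zero, h.two, e0, e2]
  refine .iadd rfl <| .istore rfl <| .iconst rfl <| .iconst rfl <| .istore rfl <| .cast rfl <|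
    .rconst rfl <| .rmul rfl <| .rconst rfl <| .radd rfl <| .rconst rfl <| .rstore rfl <|
    .iconst rfl <| .done ⟨rfl, ?_⟩
  simp (disch := omega) only [Function.update_self, Function.update_of_ne, h1]
  generalize hK : Function.update (Function.update _ 18 _) 7 _ = K
  have hKe : ∀ e : ℕ, e < 4 ∨ 16 ≤ e → e ≠ 16 * root + 17 → e ≠ 18 → K e = I e := by
    intro e e1 e2 e3
    subst hK
    simp (disch := omega) only [Function.update_of_ne]
  have hKf : K (16 * root + 17) = 1 := by
    subst hK
    simp (disch := omega) only [Function.update_of_ne, Function.update_self]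
  have hKq : K 18 = 16 * root + 16 := by
    subst hK
    simp (disch := omega) only [Function.update_of_ne, Function.update_self]
  have hK4 : K 4 = n := by subst hK; simp (disch := omega) [Function.update_of_ne]
  have hK5 : K 5 = 18 := by subst hK; simp (disch := omega) [Function.update_of_ne]
  have hK6 : K 6 = 34 := by subst hK; simp (disch := omega) [Function.update_of_ne]
  have hK7 : K 7 = 0 := by subst hK; simp
  clear hK
  have hframe : ∀ {p : ℕ} {l : List (Fin n)}, Chain I (I 7) p l → Chain K (I 7) p l := fun hc =>
    hc.frame le_rfl (by omega) fun e he _ _ => hKe e (by omega) (by omega) (by omega)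
  constructor
  any_goals simp (disch := omega) only [hKe, h.zero, h1, h3]
  · exact hK4
  · refine ⟨0, hK5, hK6, fun i hi => ?_⟩
    obtain rfl : i = 0 := by simpa using hi
    simpa using hKq
  · intro v hv
    obtain rfl : v = root := by simpa using hv
    exact hKf
  · intro v hv
    have : v ≠ root := by simpa using hv
    have : (v : ℕ) ≠ root := fun e => this (Fin.ext e)
    rw [hKe _ (by omega) (by omega) (by omega)]
    exact h.flag v
  · exact fun v => hframe (hL v)
  · exact hK7
  · simp (disch := omega) only [Function.update_of_ne, Function.update_self]
    rw [hq]; push_cast; ring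
  · simp (disch := omega) [Function.update_of_ne]
  · simp
  · simp
  · simp
  · refine ⟨?_, fun w hw => ?_, fun w hw hne => ?_⟩
    -- The parameter of the root is never written; it is the initial zero of the real memory.
    · simp (disch := omega) only [Function.update_of_ne]
    · obtain rfl : w = root := by simpa using hw
      simp [levelScale]
    · exact absurd (by simpa using hw) hne
  · simp
  · simp

end BreadthFirstSearch

/-! ### Third phase: coordinates from parameters and scales. -/

section OutputPhase

open RealRAM

variable {n m : ℕ} {x : ℕ → ℕ}

/-- The configuration when the coordinates of the vertices below `j` have been output, where `R₀`
is the real memory that holds the parameters and scales. -/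
structure OutputInv (n : ℕ) (R₀ : ℕ → ℝ) (j : ℕ) (I : ℕ → ℕ) (R o : ℕ → ℝ) : Prop where
  zero : I 0 = 0
  one : I 1 = 1
  three : I 3 = 16
  four : I 4 = n
  five : I 5 = 2 * j
  six : I 6 = 16 * j + 16
  seven : I 7 = j
  one_eq : R 3 = 1
  eq_256 : R 7 = 256
  frame : ∀ e, 16 ≤ e → R e = R₀ e
  fst : ∀ v < j, o (2 * v) = (1 + R₀ (16 * v + 17) ^ 2 / 256) *
    (2 * R₀ (16 * v + 16) / (1 + R₀ (16 * v + 16) ^ 2))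
  snd : ∀ v < j, o (2 * v + 1) = (1 + R₀ (16 * v + 17) ^ 2 / 256) *
    ((1 - R₀ (16 * v + 16) ^ 2) / (1 + R₀ (16 * v + 16) ^ 2))

theorem within_output_step {R₀ : ℕ → ℝ} {j : ℕ} (hj : j < n) {I : ℕ → ℕ} {R o : ℕ → ℝ}
    (h : OutputInv n R₀ j I R o) :
    Within drawProgram x 22 ⟨89, I, R, o⟩
      fun c => c.pc = 89 ∧ OutputInv n R₀ (j + 1) c.I c.R c.out := by
  have h1 := h.one
  have h3 := h.three
  have ht := h.frame (16 * j + 16) (by omega)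
  have he := h.frame (16 * j + 17) (by omega)
  refine .ijump_not_taken rfl (by rw [h.four, h.seven]; omega) ?_
  refine .rload rfl <| .iadd rfl <| .rload rfl <| .rmul rfl <| .rdiv rfl ?_ <| .radd rfl <|
    .rmul rfl <| .radd rfl <| .rsub rfl <| .radd rfl ?_
  · simp (disch := omega) only [Function.update_of_ne, h.eq_256]; norm_num
  simp (disch := omega) only [Function.update_self, Function.update_of_ne, h1, h.six, add_assoc,
    Nat.reduceAdd, ht, he, h.one_eq, h.eq_256]
  set t := R₀ (16 * j + 16) with ht'
  set s := R₀ (16 * j + 17) with hs'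
  have hpos : 1 + t * t ≠ 0 := by nlinarith [mul_self_nonneg t]
  generalize hJ : Function.update (Function.update (Function.update _ 8 _) 9 _) 4 _ = J
  have hJ4 : J 4 = t + t := by subst hJ; simp
  have hJ9 : J 9 = 1 - t * t := by subst hJ; simp (disch := omega) [Function.update_of_ne]
  have hJ8 : J 8 = 1 + t * t := by subst hJ; simp (disch := omega) [Function.update_of_ne]
  have hJ5 : J 5 = 1 + s * s / 256 := by subst hJ; simp (disch := omega) [Function.update_of_ne]
  have hJe : ∀ e, e = 3 ∨ e = 7 ∨ 16 ≤ e → J e = R e := by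
    intro e he
    subst hJ
    simp (disch := omega) only [Function.update_of_ne]
  clear hJ
  refine .rdiv rfl (by rw [hJ8]; exact hpos) <| .rdiv rfl ?_ <| .rmul rfl <| .rmul rfl <|
    .output rfl <| .iadd rfl <| .output rfl <| .iadd rfl <| .iadd rfl <| .iadd rfl <|
    .ijump_taken rfl le_rfl <| .done ⟨rfl, ?_⟩
  · simp (disch := omega) only [Function.update_of_ne, hJ8]; exact hpos
  simp (disch := omega) only [Function.update_self, Function.update_of_ne, h1, h3, h.five, h.six,
    h.seven, hJ4, hJ5, hJ8, hJ9, add_assoc, Nat.reduceAdd]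
  constructor
  any_goals simp (disch := omega) only [Function.update_self, Function.update_of_ne, h.zero, h1,
    h3, h.four, hJe, h.one_eq, h.eq_256]
  · ring
  · ring
  · intro e he
    simp (disch := omega) only [Function.update_of_ne, hJe]
    exact h.frame e he
  · intro v hv
    rcases Nat.lt_succ_iff_lt_or_eq.1 hv with hv | rfl
    · simp (disch := omega) only [Function.update_of_ne]
      exact h.fst v hv
    · simp (disch := omega) only [Function.update_self]
      rw [← ht', ← hs']; ring
  · intro v hv
    rcases Nat.lt_succ_iff_lt_or_eq.1 hv with hv | rfl
    · simp (disch := omega) only [Function.update_of_ne]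
      exact h.snd v hv
    · simp (disch := omega) only [Function.update_self]
      rw [← ht', ← hs']; ring

theorem within_output {I : ℕ → ℕ} {R o : ℕ → ℝ} (h0 : I 0 = 0) (h1 : I 1 = 1) (h3 : I 3 = 16)
    (h4 : I 4 = n) (hR : R 3 = 1) :
    Within drawProgram x (4 + (22 * n + 1)) ⟨85, I, R, o⟩ fun c =>
      drawProgram[c.pc]? = some .halt ∧ OutputInv n R n c.I c.R c.out := by
  have key : ∀ r j : ℕ, j + r = n → ∀ I R' o, OutputInv n R j I R' o →
      Within drawProgram x (22 * r + 1) ⟨89, I, R', o⟩ fun c =>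
        drawProgram[c.pc]? = some .halt ∧ OutputInv n R n c.I c.R c.out := by
    intro r
    induction r with
    | zero =>
      intro j hj I R' o h
      obtain rfl : j = n := hj
      exact .ijump_taken rfl (by rw [h.four, h.seven]) <| .done ⟨rfl, h⟩
    | succ r ih =>
      intro j hj I R' o h
      refine ((within_output_step (by omega) h).trans ?_).mono
        (show 22 + (22 * r + 1) ≤ _ by omega)
      rintro ⟨pc, I', R', o'⟩ ⟨rfl, hI'⟩
      exact ih (j + 1) (by omega) I' R' o' hI'
  refine Within.mono (T := 22 * n + 1 + 4) ?_ (by omega)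
  refine .rconst rfl <| .iconst rfl <| .iconst rfl <| .iconst rfl <| key n 0 (by omega) _ _ _ ?_
  constructor <;> try simp [h0, h1, h3, h4, hR]
  intro e he
  rw [Function.update_of_ne (by omega)]

end OutputPhase

/-! ### The three phases together. -/

section Correctness

open RealRAM

variable {n m : ℕ} {G S : SimpleGraph (Fin n)} {root : Fin n} {ends : Fin m → Fin n × Fin n}
  {mark : Fin m → Bool}

theorem IsEdgeList.adj (h : IsEdgeList G S ends mark) (i : Fin m) :
    G.Adj (ends i).1 (ends i).2 := by
  rw [← SimpleGraph.mem_edgeSet, ← h.range_eq]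
  exact ⟨i, rfl⟩

theorem IsEdgeList.exists_mark_iff (h : IsEdgeList G S ends mark) (hle : S ≤ G) (v w : Fin n) :
    (∃ i : Fin m, i < m ∧ mark i = true ∧ (ends i = (v, w) ∨ ends i = (w, v))) ↔ S.Adj v w := by
  constructor
  · rintro ⟨i, -, hm, he | he⟩
    · simpa [he] using (h.mark_iff i).1 hm
    · simpa [he] using ((h.mark_iff i).1 hm).symm
  · intro hvw
    have : s(v, w) ∈ G.edgeSet := hle hvw
    rw [← h.range_eq] at this
    obtain ⟨i, hi⟩ := this
    rcases Sym2.eq_iff.1 hi with ⟨h1, h2⟩ | ⟨h1, h2⟩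
    · exact ⟨i, i.2, (h.mark_iff i).2 (by rwa [h1, h2]), .inl (Prod.ext h1 h2)⟩
    · exact ⟨i, i.2, (h.mark_iff i).2 (by rw [h1, h2]; exact hvw.symm), .inr (Prod.ext h1 h2)⟩

/-- The constant used by the drawing program for instances with `n` vertices. -/
def scaleFactor (n : ℕ) : ℝ := 16384 * n + 1024

theorem PlacedInv.isParameterization (hS : S.IsTree) {R : ℕ → ℝ}
    (h : PlacedInv S root (scaleFactor n) R fun _ => True) :
    IsParameterization S root (16 * n) (scaleFactor n) (fun v => (16 * v + 16 : ℕ))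
      (fun v => R (16 * v + 16)) := by
  -- Record addresses serve as multipliers: they are positive, distinct and at most `16 * n`, and
  -- `scaleFactor n` equals `1024 * (16 * n + 1)`.
  refine ⟨fun v => ?_, fun v => ?_, fun v w hne => ?_, ?_, h.root_eq, fun u w huw hd => ?_⟩
  · exact_mod_cast (by omega : 1 ≤ 16 * (v : ℕ) + 16)
  · exact_mod_cast (by omega : 16 * (v : ℕ) + 16 ≤ 16 * n)
  · have h1 : ((16 * v + 16 : ℕ) : ℤ) ≠ (16 * w + 16 : ℕ) := by
      intro h
      exact hne (Fin.ext (by omega))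
    have h2 : 1 ≤ |((16 * v + 16 : ℕ) : ℤ) - (16 * w + 16 : ℕ)| :=
      Int.one_le_abs (sub_ne_zero.2 h1)
    exact_mod_cast h2
  · rw [scaleFactor]; linarith
  · have hne : w ≠ root := by
      rintro rfl
      simp at hd
    obtain ⟨p, -, h2, h3, h4⟩ := h.parent w trivial hne
    obtain rfl := hS.parent_unique h2 huw h3 hd
    exact h4

/-- The program halts in linear time and computes the placement of the vertices that is given by
the addresses of their records. -/
theorem drawProgram_correct (hT : IsBFSTree G S root) (hE : IsEdgeList G S ends mark) :
    ∃ (t : ℕ) (y : ℕ → ℝ), t ≤ 100 * (n + m) ∧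
      HaltsWith drawProgram (encodeInstance ends mark root) t y ∧
      ∃ τ : Fin n → ℝ, IsParameterization S root (16 * n) (scaleFactor n)
        (fun v => (16 * v + 16 : ℕ)) τ ∧
        decodeDrawing n y = placement S root (scaleFactor n) τ := by
  have hn : 0 < n := root.pos
  have main : Within drawProgram (encodeInstance ends mark root)
      (6 + (33 * m + 1) + (20 + (16 * (n + 2 * m) + 2 + (4 + (22 * n + 1))))) Config.init
      fun c => drawProgram[c.pc]? = some .halt ∧
        ∃ τ : Fin n → ℝ, IsParameterization S root (16 * n) (scaleFactor n)
        (fun v => (16 * v + 16 : ℕ)) τ ∧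
        decodeDrawing n c.out = placement S root (scaleFactor n) τ := by
    refine (within_adjacency fun i => (hE.adj i).ne).trans ?_
    rintro ⟨pc, I, R, o⟩ ⟨rfl, hR, hI⟩
    simp only at hR hI
    subst hR
    obtain ⟨L, hL, hsum, hmem⟩ := hI.lists
    have hmem' : ∀ v w, w ∈ L v ↔ S.Adj v w := fun v w =>
      (hmem v w).trans (hE.exists_mark_iff hT.le v w)
    refine (within_search_init (S := S) (q := scaleFactor n) hI hL rfl).trans ?_
    rintro ⟨pc, I', R', o'⟩ ⟨rfl, hs⟩
    have hq : scaleFactor n ≠ 0 := by rw [scaleFactor]; positivity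
    refine (within_search hT.isTree hmem' hq (by have := hI.free_mod; omega) (n + 2 * m)
      _ _ _ _ _ _ hs ?_).trans ?_
    · simpa [Finset.sum_add_distrib] using hsum
    rintro ⟨pc, I'', R'', o''⟩ ⟨rfl, h0, h1, h3, h4, hR3, hp⟩
    obtain ⟨k, hk, c, hr, hh, ho⟩ := within_output (x := encodeInstance ends mark root)
      (o := o'') h0 h1 h3 h4 hR3
    refine ⟨k, hk, c, hr, hh, _, hp.isParameterization hT.isTree, ?_⟩
    funext v
    have hsc : R'' (16 * v + 17) = _ := hp.scale v trivial
    rw [decodeDrawing, placement, circlePoint, ho.fst v v.2, ho.snd v v.2]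
    simp only
    rw [hsc]
  obtain ⟨t, ht, c, hc, hQ⟩ := main.exists_haltsWith
  -- The total is `38 * n + 65 * m + 34`; the additive constant is absorbed because there is at
  -- least one vertex.
  exact ⟨t, c.out, by omega, hc, hQ⟩

end Correctness

/-! ### Lower bounds for the area of a drawing. -/

section Area

variable {V : Type u}

/-- Twice the signed area of the triangle of three vertices. -/
def triangleDet (Γ : V → Plane) (a b c : V) : ℝ :=
  (Γ b 0 - Γ a 0) * (Γ c 1 - Γ a 1) - (Γ c 0 - Γ a 0) * (Γ b 1 - Γ a 1)

theorem exists_scaling [Finite V] {Γ : V → Plane} (h : Function.Injective Γ) :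
    ∃ s : ℝ, 0 < s ∧ ∀ v w, v ≠ w → 1 ≤ s * dist (Γ v) (Γ w) := by
  have := Fintype.ofFinite V
  have hnn : ∀ p ∈ (Finset.univ : Finset (V × V)), 0 ≤ (dist (Γ p.1) (Γ p.2))⁻¹ :=
    fun p _ => by positivity
  refine ⟨1 + ∑ p : V × V, (dist (Γ p.1) (Γ p.2))⁻¹, ?_, fun v w hne => ?_⟩
  · have := Finset.sum_nonneg hnn
    linarith
  · have h1 := Finset.single_le_sum hnn (Finset.mem_univ (v, w))
    have h2 : 0 < dist (Γ v) (Γ w) := dist_pos.2 fun e => hne (h e)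
    calc (1 : ℝ) = (dist (Γ v) (Γ w))⁻¹ * dist (Γ v) (Γ w) := (inv_mul_cancel₀ h2.ne').symm
      _ ≤ _ := by gcongr; simp only at h1; linarith

/-- The area of a drawing is at least that of a triangle, measured by the distance of two points. -/
theorem le_drawingArea [Finite V] {Γ : V → Plane} (h : Function.Injective Γ) (a b c : V)
    {v w : V} (hvw : v ≠ w) :
    |triangleDet Γ a b c| / (2 * dist (Γ v) (Γ w) ^ 2) ≤ drawingArea Γ := by
  have hpos : 0 < dist (Γ v) (Γ w) := dist_pos.2 fun e => hvw (h e)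
  refine le_csInf ?_ ?_
  · obtain ⟨s, hs, hd⟩ := exists_scaling h
    have bdd : ∀ f : V → ℝ, ∃ x y : ℝ, ∀ v, f v ∈ Set.Icc x y := fun f => by
      obtain ⟨x, hx⟩ := (Set.finite_range f).bddBelow
      obtain ⟨y, hy⟩ := (Set.finite_range f).bddAbove
      exact ⟨x, y, fun v => ⟨hx ⟨v, rfl⟩, hy ⟨v, rfl⟩⟩⟩
    obtain ⟨x, y, hxy⟩ := bdd fun v => s * (Real.cos 0 * Γ v 0 + Real.sin 0 * Γ v 1)
    obtain ⟨x', y', hxy'⟩ := bdd fun v => s * (-Real.sin 0 * Γ v 0 + Real.cos 0 * Γ v 1)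
    exact ⟨_, s, 0, x, y, x', y', hs, hd, fun v => ⟨hxy v, hxy' v⟩, rfl⟩
  · rintro A ⟨s, θ, x, y, x', y', hs, hd, hbox, rfl⟩
    set p : V → ℝ := fun v => s * (Real.cos θ * Γ v 0 + Real.sin θ * Γ v 1) with hp
    set q : V → ℝ := fun v => s * (-Real.sin θ * Γ v 0 + Real.cos θ * Γ v 1) with hq
    -- Rotation preserves the determinant and scaling multiplies it by `s ^ 2`.
    have hdet : (p b - p a) * (q c - q a) - (p c - p a) * (q b - q a) =
        s ^ 2 * triangleDet Γ a b c := by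
      have h1 := Real.sin_sq_add_cos_sq θ
      simp only [hp, hq, triangleDet]
      linear_combination (s ^ 2 * ((Γ b 0 - Γ a 0) * (Γ c 1 - Γ a 1) -
        (Γ c 0 - Γ a 0) * (Γ b 1 - Γ a 1))) * h1
    have hpw : ∀ v w, |p v - p w| ≤ y - x := fun v w => by
      rw [abs_le]
      constructor <;> linarith [(hbox v).1.1, (hbox v).1.2, (hbox w).1.1, (hbox w).1.2]
    have hqw : ∀ v w, |q v - q w| ≤ y' - x' := fun v w => by
      rw [abs_le]
      constructor <;> linarith [(hbox v).2.1, (hbox v).2.2, (hbox w).2.1, (hbox w).2.2]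
    have hW : 0 ≤ y - x := (abs_nonneg _).trans (hpw a a)
    have hbound : s ^ 2 * |triangleDet Γ a b c| ≤ 2 * ((y - x) * (y' - x')) := by
      have e : s ^ 2 * |triangleDet Γ a b c| = |s ^ 2 * triangleDet Γ a b c| := by
        rw [abs_mul, abs_of_nonneg (sq_nonneg s)]
      rw [e, ← hdet]
      refine (abs_sub _ _).trans ?_
      rw [abs_mul, abs_mul]
      have h1 := mul_le_mul (hpw b a) (hqw c a) (abs_nonneg _) hW
      have h2 := mul_le_mul (hpw c a) (hqw b a) (abs_nonneg _) hW
      linarith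
    have h1 : 1 ≤ s ^ 2 * dist (Γ v) (Γ w) ^ 2 := by
      rw [← mul_pow]
      exact one_le_pow₀ (hd v w hvw)
    rw [div_le_iff₀ (by positivity)]
    have h2 : 0 ≤ |triangleDet Γ a b c| := abs_nonneg _
    have h3 : |triangleDet Γ a b c| ≤
        (s ^ 2 * |triangleDet Γ a b c|) * dist (Γ v) (Γ w) ^ 2 := by nlinarith
    have h4 : (s ^ 2 * |triangleDet Γ a b c|) * dist (Γ v) (Γ w) ^ 2 ≤
      2 * ((y - x) * (y' - x')) * dist (Γ v) (Γ w) ^ 2 := by gcongr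
    linarith

/-- The determinant factors into parameter differences, so separation on one level bounds it from
below. -/
theorem circlePoint_det (r a b c : ℝ) :
    (circlePoint r b 0 - circlePoint r a 0) * (circlePoint r c 1 - circlePoint r a 1) -
      (circlePoint r c 0 - circlePoint r a 0) * (circlePoint r b 1 - circlePoint r a 1) =
    r ^ 2 * (4 * ((b - a) * (b - c) * (c - a))) / ((1 + a ^ 2) * (1 + b ^ 2) * (1 + c ^ 2)) := by
  have h1 : 1 + a ^ 2 ≠ 0 := by positivity
  have h2 : 1 + b ^ 2 ≠ 0 := by positivity
  have h3 : 1 + c ^ 2 ≠ 0 := by positivity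
  simp [circlePoint]
  field_simp
  ring

/-- The decay is in fact doubly exponential; a geometric bound suffices for the area. -/
theorem levelScale_mul_pow_le {q : ℝ} (hq : 1 ≤ q) (l : ℕ) : levelScale q l * q ^ l ≤ 1 := by
  induction l with
  | zero => simp [levelScale]
  | succ l ih =>
    have h1 := levelScale_succ_mul_le hq l
    calc levelScale q (l + 1) * q ^ (l + 1) = q * levelScale q (l + 1) * q ^ l := by ring
      _ ≤ levelScale q l * q ^ l := by gcongr
      _ ≤ 1 := ih

/-- The triangle of three vertices on the first level is large. -/
theorem IsParameterization.le_triangleDet {S : SimpleGraph V} {root : V} {N q : ℝ} {f t : V → ℝ}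
    (h : IsParameterization S root N q f t) (hS : S.Connected) {a b c : V} (hab : a ≠ b)
    (hbc : b ≠ c) (hca : c ≠ a) (ha : S.dist root a = 1) (hb : S.dist root b = 1)
    (hc : S.dist root c = 1) :
    (q ^ 3)⁻¹ / 2 ≤ |triangleDet (placement S root q t) a b c| := by
  have hq := h.q_ge
  have e1 : levelScale q 1 = q⁻¹ := by simp [levelScale]
  have hab' := h.t_sep hS 1 b a hab.symm hb ha
  have hbc' := h.t_sep hS 1 b c hbc hb hc
  have hca' := h.t_sep hS 1 c a hca hc ha
  rw [e1] at hab' hbc' hca'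
  have hq0 : 0 < q⁻¹ := by positivity
  have hden : ∀ v, 1 + t v ^ 2 ≤ 2 := fun v => by
    have := h.t_mem hS v
    nlinarith
  have hr : 1 ≤ (1 + levelScale q 1 ^ 2 / 256) ^ 2 := by
    have : 0 ≤ levelScale q 1 ^ 2 / 256 := by positivity
    nlinarith
  rw [triangleDet, placement, placement, placement, ha, hb, hc, circlePoint_det, abs_div,
    abs_of_pos (by positivity : 0 < (1 + t a ^ 2) * (1 + t b ^ 2) * (1 + t c ^ 2)),
    le_div_iff₀ (by positivity), abs_mul, abs_mul, abs_mul, abs_mul,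
    abs_of_nonneg (by positivity : (0 : ℝ) ≤ (1 + levelScale q 1 ^ 2 / 256) ^ 2),
    abs_of_pos (by norm_num : (0 : ℝ) < 4)]
  have h1 : q⁻¹ * q⁻¹ * q⁻¹ ≤ |t b - t a| * |t b - t c| * |t c - t a| := by gcongr
  have h2 : (1 + t a ^ 2) * (1 + t b ^ 2) * (1 + t c ^ 2) ≤ 2 * 2 * 2 := by
    gcongr <;> exact hden _
  calc (q ^ 3)⁻¹ / 2 * ((1 + t a ^ 2) * (1 + t b ^ 2) * (1 + t c ^ 2))
      ≤ (q ^ 3)⁻¹ / 2 * (2 * 2 * 2) := by gcongr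
    _ = 1 * (4 * (q⁻¹ * q⁻¹ * q⁻¹)) := by rw [← inv_pow]; ring
    _ ≤ _ := by gcongr

end Area

/-! ### A family of trees with exponential area. -/

section Instance

variable {n : ℕ}

/-- Parents have smaller numbers, so no edge is listed twice, once from each end. -/
theorem isEdgeList_parentGraph {parent : Fin (n + 1) → Fin (n + 1)}
    (hp : ∀ v, v ≠ 0 → parent v < v) {lev : Fin (n + 1) → ℕ}
    (hlev : ∀ v, v ≠ 0 → lev (parent v) + 1 = lev v) :
    IsEdgeList (parentGraph 0 parent) (parentGraph 0 parent)
      (fun j : Fin n => (j.succ, parent j.succ)) (fun _ => true) := by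
  refine ⟨fun i j hij => ?_, ?_, fun j => ?_⟩
  · rcases Sym2.eq_iff.1 hij with ⟨h1, -⟩ | ⟨h1, h2⟩
    · exact Fin.succ_injective _ h1
    · have h3 := hp i.succ (Fin.succ_ne_zero i)
      have h4 := hp j.succ (Fin.succ_ne_zero j)
      simp only at h1 h2
      rw [h2] at h3
      rw [← h1] at h4
      exact absurd h3 h4.asymm
  · ext e
    induction e with
    | _ a b =>
      rw [SimpleGraph.mem_edgeSet, parentGraph_adj_iff hlev]
      constructor
      · rintro ⟨j, hj⟩
        rcases Sym2.eq_iff.1 hj with ⟨h1, h2⟩ | ⟨h1, h2⟩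
        · exact .inl ⟨h1 ▸ Fin.succ_ne_zero j, by rw [← h1]; exact h2.symm⟩
        · exact .inr ⟨h1 ▸ Fin.succ_ne_zero j, by rw [← h1]; exact h2.symm⟩
      · rintro (⟨h1, rfl⟩ | ⟨h1, rfl⟩)
        · obtain ⟨j, rfl⟩ := Fin.exists_succ_eq.2 h1
          exact ⟨j, rfl⟩
        · obtain ⟨j, rfl⟩ := Fin.exists_succ_eq.2 h1
          exact ⟨j, Sym2.eq_swap⟩
  · simp only [true_iff]
    rw [parentGraph_adj_iff hlev]
    exact .inl ⟨Fin.succ_ne_zero j, rfl⟩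

theorem isBFSTree_self {V : Type u} {S : SimpleGraph V} (hS : S.IsTree) (root : V) :
    IsBFSTree S S root :=
  ⟨le_rfl, hS, fun _ _ h h' => absurd h h'⟩

/-- Three paths from the root, two of them with a single edge and the third one with the other
vertices. -/
def broomParent (v : Fin (n + 1)) : Fin (n + 1) :=
  ⟨if (v : ℕ) ≤ 3 then 0 else v - 1, by split_ifs <;> omega⟩

/-- The levels of the tree given by `broomParent`. -/
def broomLevel (v : Fin (n + 1)) : ℕ :=
  if v = 0 then 0 else if (v : ℕ) ≤ 3 then 1 else v - 2

theorem broomParent_lt (v : Fin (n + 1)) (hv : v ≠ 0) : broomParent v < v := by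
  have : (v : ℕ) ≠ 0 := fun e => hv (Fin.ext e)
  rw [Fin.lt_def, broomParent]
  simp only
  split_ifs <;> omega

theorem broomLevel_parent (v : Fin (n + 1)) (hv : v ≠ 0) :
    broomLevel (broomParent v) + 1 = broomLevel v := by
  have : (v : ℕ) ≠ 0 := fun e => hv (Fin.ext e)
  simp only [broomLevel, broomParent, Fin.ext_iff, Fin.val_zero]
  split_ifs <;> omega

/-- The three vertices on level 1 span a triangle of determinant at least `(q ^ 3)⁻¹ / 2`, while the
last edge of the path has length at most `s ^ 2 / 128` with `s ≤ q⁻¹ ^ (n - 3)`. Scaling that edge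
to length 1 blows up the triangle. -/
theorem le_drawingArea_broom {τ : Fin (n + 1) → ℝ} (hn : 6 ≤ n)
    (h : IsParameterization (parentGraph 0 broomParent) 0 (16 * (n + 1 : ℕ)) (scaleFactor (n + 1))
      (fun v => (16 * v + 16 : ℕ)) τ) :
    1 * 2 ^ (n + 1) ≤
      drawingArea (placement (parentGraph 0 broomParent) 0 (scaleFactor (n + 1)) τ) := by
  have hS := parentGraph_isTree (broomLevel_parent (n := n))
  have hd := parentGraph_dist (lev := broomLevel (n := n)) (by simp [broomLevel]) broomLevel_parent
  have hfine := h.isFinePlacement hS.connected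
  have hq := h.q_ge
  set q := scaleFactor (n + 1)
  set S := parentGraph (0 : Fin (n + 1)) broomParent
  have hlv : ∀ (k : ℕ) (hk : k < n + 1), S.dist 0 ⟨k, hk⟩ =
      if k = 0 then 0 else if k ≤ 3 then 1 else k - 2 := by
    intro k hk
    rw [hd, broomLevel]
    simp only [Fin.ext_iff, Fin.val_zero]
  have hdet := h.le_triangleDet hS.connected
    (a := ⟨1, by omega⟩) (b := ⟨2, by omega⟩) (c := ⟨3, by omega⟩)
    (by simp) (by simp) (by simp) (by rw [hlv]; rfl) (by rw [hlv]; rfl) (by rw [hlv]; rfl)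
  have hadj : S.Adj ⟨n - 1, by omega⟩ ⟨n, by omega⟩ := by
    rw [parentGraph_adj_iff broomLevel_parent]
    refine .inr ⟨by simp [Fin.ext_iff]; omega, ?_⟩
    simp only [broomParent, Fin.ext_iff]
    split_ifs <;> omega
  have hl1 : S.dist 0 ⟨n - 1, by omega⟩ = n - 3 := by rw [hlv]; split_ifs <;> omega
  have hl2 : S.dist 0 ⟨n, by omega⟩ = n - 3 + 1 := by rw [hlv]; split_ifs <;> omega
  have hedge := hfine.edge _ _ hadj (by rw [hl1, hl2])
  rw [hl1, ← dist_eq_norm] at hedge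
  have harea := le_drawingArea hfine.injective ⟨1, by omega⟩ ⟨2, by omega⟩ ⟨3, by omega⟩ hadj.ne'
  refine le_trans ?_ harea
  have hdpos : 0 < dist (placement S 0 q τ ⟨n, by omega⟩) (placement S 0 q τ ⟨n - 1, by omega⟩) :=
    dist_pos.2 fun e => hadj.ne' (hfine.injective e)
  rw [le_div_iff₀ (by positivity)]
  refine le_trans ?_ hdet
  have hs0 := levelScale_pos (by linarith : 0 < q) (n - 3)
  have hs := levelScale_mul_pow_le (by linarith : 1 ≤ q) (n - 3)
  set s := levelScale q (n - 3)
  have h1 : dist (placement S 0 q τ ⟨n, by omega⟩) (placement S 0 q τ ⟨n - 1, by omega⟩) ^ 2 ≤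
      (s ^ 2 / 128) ^ 2 := by gcongr
  have h2 : (s * q ^ (n - 3)) ^ 4 ≤ 1 := pow_le_one₀ (by positivity) hs
  have h3 : (2 : ℝ) ^ (n + 1) * q ^ 3 ≤ q ^ (4 * (n - 3)) := by
    calc (2 : ℝ) ^ (n + 1) * q ^ 3 ≤ q ^ (n + 1) * q ^ 3 := by gcongr; linarith
      _ = q ^ (n + 4) := by ring
      -- The comparison `n + 4 ≤ 4 * (n - 3)` needs `3 * n ≥ 16`, hence the bound `6 ≤ n`.
      _ ≤ q ^ (4 * (n - 3)) := pow_le_pow_right₀ (by linarith) (by omega)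
  have h4 : s ^ 4 * (2 ^ (n + 1) * q ^ 3) ≤ 1 := by
    calc s ^ 4 * (2 ^ (n + 1) * q ^ 3) ≤ s ^ 4 * q ^ (4 * (n - 3)) := by gcongr
      _ = (s * q ^ (n - 3)) ^ 4 := by rw [mul_pow, ← pow_mul, mul_comm 4]
      _ ≤ 1 := h2
  have h5 : s ^ 4 * 2 ^ (n + 1) ≤ (q ^ 3)⁻¹ := by
    rw [le_inv_comm₀ (by positivity) (by positivity)]
    rw [← one_div, le_div_iff₀ (by positivity)]
    linarith
  calc 1 * 2 ^ (n + 1) * (2 * dist (placement S 0 q τ ⟨n, by omega⟩)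
        (placement S 0 q τ ⟨n - 1, by omega⟩) ^ 2)
      ≤ 1 * 2 ^ (n + 1) * (2 * (s ^ 2 / 128) ^ 2) := by gcongr
    _ = s ^ 4 * 2 ^ (n + 1) / 8192 := by ring
    _ ≤ (q ^ 3)⁻¹ / 2 := by
      have : 0 ≤ s ^ 4 * 2 ^ (n + 1) := by positivity
      linarith

end Instance

theorem theorem3 :
    -- every BFS-tree has a compatible drawing, with the levels on nested concentric circles
    (∀ (V : Type u) [Finite V] (G S : SimpleGraph V) (root : V), IsBFSTree G S root →
      ∃ Γ : V → Plane, IsCompatibleDrawing G S Γ ∧ LevelsOnNestedCircles S root Γ) ∧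
    -- such drawings are computed by one program in linear time on a real RAM
    (∃ P : RealRAM.Program,
      (∃ C : ℕ, ∀ (n m : ℕ) (G S : SimpleGraph (Fin n)) (root : Fin n)
        (ends : Fin m → Fin n × Fin n) (mark : Fin m → Bool),
        IsBFSTree G S root → IsEdgeList G S ends mark →
        ∃ (t : ℕ) (y : ℕ → ℝ), t ≤ C * (n + m) ∧
          RealRAM.HaltsWith P (encodeInstance ends mark root) t y ∧
          IsCompatibleDrawing G S (decodeDrawing n y) ∧
          LevelsOnNestedCircles S root (decodeDrawing n y)) ∧
      -- whose drawings may have exponential area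
      (∃ c : ℝ, 0 < c ∧ ∃ n₀ : ℕ, ∀ n ≥ n₀,
        ∃ (m : ℕ) (G S : SimpleGraph (Fin n)) (root : Fin n)
          (ends : Fin m → Fin n × Fin n) (mark : Fin m → Bool),
          IsBFSTree G S root ∧ IsEdgeList G S ends mark ∧
          ∃ (t : ℕ) (y : ℕ → ℝ), RealRAM.HaltsWith P (encodeInstance ends mark root) t y ∧
            c * 2 ^ n ≤ drawingArea (decodeDrawing n y))) ∧
    -- every connected graph has, for every choice of the root, a spanning tree that is a BFS-tree,
    -- and hence a straight-line drawing in which this tree is not crossed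
    (∀ (V : Type u) [Finite V] (G : SimpleGraph V), G.Connected → ∀ root : V,
      ∃ S : SimpleGraph V, IsBFSTree G S root ∧
        ∃ Γ : V → Plane, IsCompatibleDrawing G S Γ) := by

  refine ⟨fun V _ G S root h => exists_compatible_drawing h, ⟨drawProgram, ⟨100, ?_⟩, 1, one_pos,
    7, fun n hn => ?_⟩, fun V _ G hG root => ?_⟩
  · intro n m G S root ends mark hT hE
    obtain ⟨t, y, ht, hy, τ, hτ, hd⟩ := drawProgram_correct hT hE
    have hfine := hτ.isFinePlacement hT.isTree.connected
    exact ⟨t, y, ht, hy, hd ▸ hfine.isCompatibleDrawing hT, hd ▸ hfine.levelsOnNestedCircles⟩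
  · obtain ⟨n, rfl⟩ := Nat.exists_eq_add_of_le' (show 1 ≤ n by omega)
    -- The graph of the bad instance is the tree itself, so the level condition is vacuous.
    have hT := isBFSTree_self (parentGraph_isTree (broomLevel_parent (n := n))) 0
    have hE := isEdgeList_parentGraph (broomParent_lt (n := n)) broomLevel_parent
    obtain ⟨t, y, -, hy, τ, hτ, hd⟩ := drawProgram_correct hT hE
    exact ⟨n, _, _, 0, _, _, hT, hE, t, y, hy, hd ▸ le_drawingArea_broom (by omega) hτ⟩
  · obtain ⟨S, hS⟩ := hG.exists_isBFSTree root
    obtain ⟨Γ, hΓ, -⟩ := exists_compatible_drawing hS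
    exact ⟨S, hS, Γ, hΓ⟩
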